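/- For a locally compact metrizable group $G$, let $\mathrm{Sub}_G$ be the space of closed subgroups of $G$ with the Chabauty topology, generated by the sets $\{A : A\cap K=\emptyset\}$ ($K\subset G$ compact) and $\{A : A\cap U\neq\emptyset\}$ ($U\subset G$ open); it is compact and metrizable. Let $T$ be an automorphism of $G$ (a group automorphism that is a homeomorphism). Call $T$ expansive if $\bigcap_{k\in\mathbb Z}T^k(U)=\{e\}$ for some neighbourhood $U$ of the identity $e$. Say that $T$ acts expansively on $\mathrm{Sub}_G$ if, for a metric $d$ inducing the topology of $\mathrm{Sub}_G$, there is $\delta>0$ such that for all $H\neq H'$ in $\mathrm{Sub}_G$ one has $d(T^k(H),T^k(H'))>\delta$ for some $k\in\mathbb Z$ (this does not depend on $d$). Let $C(T)=\{x\in G : T^k(x)\to e \text{ as } k\to\infty\}$. Let $p_1,\dots,p_n$ be distinct primes, and regard the fields $\mathbb Q_{p_i}$ of $p_i$-adic numbers and products of them as additive topological groups. (1) Let $G=\mathbb Q_{p_1}^{m_1}\times\cdots\times\mathbb Q_{p_n}^{m_n}$ with integers $m_i\ge 1$, and let $T$ be an automorphism of $G$. If $T$ is expansive, then $T(\mathbb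 Q_{p_i}^{m_i})=\mathbb Q_{p_i}^{m_i}$ for each $i$, and $G=C(T)\times C(T^{-1})$, that is, $(x,y)\mapsto x+y$ is an isomorphism of topological groups from $C(T)\times C(T^{-1})$ onto $G$. Moreover, if $T$ acts expansively on $\mathrm{Sub}_G$, then $m_1=\cdots=m_n=1$. (2) Let $G=\mathbb Q_{p_1}\times\cdots\times\mathbb Q_{p_n}$. An automorphism $T$ of $G$ is expansive if and only if it acts expansively on $\mathrm{Sub}_G$. Furthermore, $\mathrm{Sub}_G=\mathrm{Sub}_{\mathbb Q_{p_1}}\times\cdots\times\mathrm{Sub}_{\mathbb Q_{p_n}}$, that is, $(H_1,\dots,H_n)\mapsto H_1\times\cdots\times H_n$ is a homeomorphism from $\prod_i\mathrm{Sub}_{\mathbb Q_{p_i}}$ onto $\mathrm{Sub}_G$. -/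

import Mathlib

/-- A homeomorphism `φ` of a topological space `X` is *expansive* if, for some metric `d` inducing
the topology of `X`, there is `δ > 0` such that any two distinct points `x`, `y` satisfy
`d (φⁿ x) (φⁿ y) > δ` for some integer `n`. On a compact metrizable space the choice of the
metric is irrelevant. -/
def IsExpansiveHomeo {X : Type*} [t : TopologicalSpace X] (φ : X ≃ₜ X) : Prop :=
  ∃ d : MetricSpace X, d.toUniformSpace.toTopologicalSpace = t ∧
    ∃ δ : ℝ, 0 < δ ∧ ∀ x y : X, x ≠ y → ∃ n : ℤ, δ < d.dist ((φ ^ n) x) ((φ ^ n) y)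

/-- An automorphism `T` of a topological group (written additively) is *expansive* if
`⋂ n : ℤ, Tⁿ(U) = {0}` for some neighbourhood `U` of the identity. -/
def IsExpansiveAut {G : Type*} [AddGroup G] [TopologicalSpace G] (T : G ≃ₜ+ G) : Prop :=
  ∃ U ∈ nhds (0 : G), ⋂ n : ℤ, (T.toHomeomorph ^ n) '' U = {0}

/-- The contraction group `C(T) = {x | Tⁿ x → 0 as n → ∞}`. -/
def contractionGroup {G : Type*} [AddGroup G] [TopologicalSpace G] [IsTopologicalAddGroup G]
    (T : G ≃ₜ+ G) : AddSubgroup G where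
  carrier := {x | Filter.Tendsto (fun n : ℕ => T^[n] x) Filter.atTop (nhds 0)}
  zero_mem' := by
    have h : ∀ n : ℕ, T^[n] (0 : G) = 0 := fun n => iterate_map_zero T n
    simpa [h] using (tendsto_const_nhds : Filter.Tendsto (fun _ : ℕ => (0 : G)) Filter.atTop (nhds 0))
  add_mem' {x y} hx hy := by
    have h : ∀ n : ℕ, T^[n] (x + y) = T^[n] x + T^[n] y := fun n => iterate_map_add T n x y
    simpa [h] using Filter.Tendsto.add hx hy
  neg_mem' {x} hx := by
    have h : ∀ n : ℕ, T^[n] (-x) = -T^[n] x := fun n => iterate_map_neg T n x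
    simpa [h] using Filter.Tendsto.neg hx

/-- The Chabauty topology on the set `Sub_G` of closed subgroups of `G`: it is generated by the sets
`{A | A ∩ K = ∅}`, `K` compact, and `{A | A ∩ U ≠ ∅}`, `U` open. -/
instance chabautyTopology (G : Type*) [AddGroup G] [TopologicalSpace G] :
    TopologicalSpace (ClosedAddSubgroup G) :=
  TopologicalSpace.generateFrom
    ({S | ∃ K : Set G, IsCompact K ∧ S = {A : ClosedAddSubgroup G | (A : Set G) ∩ K = ∅}} ∪
     {S | ∃ U : Set G, IsOpen U ∧ S = {A : ClosedAddSubgroup G | ((A : Set G) ∩ U).Nonempty}})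

/-- The image `T(H)` of a closed subgroup `H` under an automorphism `T`. -/
def ClosedAddSubgroup.image {G : Type*} [AddGroup G] [TopologicalSpace G] (T : G ≃ₜ+ G)
    (H : ClosedAddSubgroup G) : ClosedAddSubgroup G where
  toAddSubgroup := H.toAddSubgroup.map (T : G →+ G)
  isClosed' := T.toHomeomorph.isClosedMap _ H.isClosed'

theorem ClosedAddSubgroup.coe_image {G : Type*} [AddGroup G] [TopologicalSpace G] (T : G ≃ₜ+ G)
    (H : ClosedAddSubgroup G) : (H.image T : Set G) = T '' (H : Set G) := rfl

theorem ClosedAddSubgroup.continuous_image {G : Type*} [AddGroup G] [TopologicalSpace G]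
    (T : G ≃ₜ+ G) : Continuous (ClosedAddSubgroup.image T) := by
  refine continuous_generateFrom_iff.2 ?_
  rintro S (⟨K, hK, rfl⟩ | ⟨U, hU, rfl⟩)
  · refine TopologicalSpace.isOpen_generateFrom_of_mem
      (Or.inl ⟨T ⁻¹' K, T.toHomeomorph.isCompact_preimage.2 hK, ?_⟩)
    ext A
    simp only [Set.mem_preimage, Set.mem_ofPred_eq, ClosedAddSubgroup.coe_image]
    rw [← Set.image_inter_preimage, Set.image_eq_empty]
  · refine TopologicalSpace.isOpen_generateFrom_of_mem
      (Or.inr ⟨T ⁻¹' U, hU.preimage T.toHomeomorph.continuous, ?_⟩)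
    ext A
    simp only [Set.mem_preimage, Set.mem_ofPred_eq, ClosedAddSubgroup.coe_image]
    rw [← Set.image_inter_preimage, Set.image_nonempty]

/-- The action `H ↦ T(H)` of an automorphism `T` of `G` on `Sub_G`, as a homeomorphism. -/
def subHomeo {G : Type*} [AddGroup G] [TopologicalSpace G] (T : G ≃ₜ+ G) :
    ClosedAddSubgroup G ≃ₜ ClosedAddSubgroup G where
  toFun := ClosedAddSubgroup.image T
  invFun := ClosedAddSubgroup.image T.symm
  left_inv H := by
    apply SetLike.coe_injective
    simp only [ClosedAddSubgroup.coe_image, ← Set.image_comp, T.symm_comp_self, Set.image_id]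
  right_inv H := by
    apply SetLike.coe_injective
    simp only [ClosedAddSubgroup.coe_image, ← Set.image_comp, T.self_comp_symm, Set.image_id]
  continuous_toFun := ClosedAddSubgroup.continuous_image T
  continuous_invFun := ClosedAddSubgroup.continuous_image T.symm

/-- `T` *acts expansively on* `Sub_G` (with the Chabauty topology). -/
def ActsExpansivelyOnSub {G : Type*} [AddGroup G] [TopologicalSpace G] (T : G ≃ₜ+ G) : Prop :=
  IsExpansiveHomeo (subHomeo T)

/-- `G` is the internal direct product of its subgroups `A` and `B` as a topological group:
`(a, b) ↦ a + b` is an isomorphism of topological groups from `A × B` onto `G`. -/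
def IsInternalDirectProduct {G : Type*} [AddGroup G] [TopologicalSpace G]
    (A B : AddSubgroup G) : Prop :=
  ∃ e : (A × B) ≃ₜ+ G, ∀ (a : A) (b : B), e (a, b) = (a : G) + (b : G)

/-- The `i`-th factor of a product of groups, as a subset of the product. -/
def factor {ι : Type*} {M : ι → Type*} [∀ i, Zero (M i)] (i : ι) : Set (∀ i, M i) :=
  {x | ∀ j, j ≠ i → x j = 0}

/-! Multiplication by `p ^ k` tends to zero on a `ℚ_[p]`-space but is isometric on a `ℚ_[q]`-space
with `q ≠ p`. Hence continuous homomorphisms between factors for different primes vanish. So `T` is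
block diagonal with blocks linear over the respective fields, and it commutes with the contraction
`σ` that multiplies the `i`-th factor by `p i`.

For the splitting, `σ` shrinks any bounded two-sided orbit into an expansive neighbourhood, so only
`0` has such an orbit, and by compactness bounded forward orbits tend to `0`. A tidying argument
writes every small vector as a sum of one with bounded backward orbit and one with bounded forward
orbit; conjugating by powers of `σ` spreads this to all of `G` and makes the inverse of addition
continuous.

For the action on closed subgroups, the conditions "`H` meets `b`", with `b` compact open, are
clopen and separate points of the compact Chabauty space, so expansiveness means that finitely many
of them separate all orbits. In dimension at least two some non-scalar `S` commutes with the block.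
The groups generated by `v` and by `v + p ^ k • S v` can be chosen distinct, yet for large `k` they
pass the same finitely many tests at all times.

In dimension one, `T` multiplies the `i`-th coordinate by some `a i`, and both notions of
expansiveness amount to `‖a i‖ ≠ 1` for all `i`. A closed subgroup of `ℚ_[p]` is determined by the
valuations of its elements, which powers of `a i` shift. Integers approximating the coordinate
idempotents show that a closed subgroup of the product is the product of its fibers. -/

open Filter Topology Metric
open scoped Pointwise

/-! ### The Chabauty space: compactness, clopen tests, metrizability -/

namespace ClosedAddSubgroup

theorem isOpen_setOf_inter_eq_empty {G : Type*} [AddGroup G] [TopologicalSpace G] {K : Set G}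
    (hK : IsCompact K) : IsOpen {A : ClosedAddSubgroup G | (A : Set G) ∩ K = ∅} :=
  TopologicalSpace.isOpen_generateFrom_of_mem (Or.inl ⟨K, hK, rfl⟩)

theorem isOpen_setOf_inter_nonempty {G : Type*} [AddGroup G] [TopologicalSpace G] {U : Set G}
    (hU : IsOpen U) : IsOpen {A : ClosedAddSubgroup G | ((A : Set G) ∩ U).Nonempty} :=
  TopologicalSpace.isOpen_generateFrom_of_mem (Or.inr ⟨U, hU, rfl⟩)

theorem isClopen_setOf_inter_nonempty {G : Type*} [AddGroup G] [TopologicalSpace G] {b : Set G}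
    (hb : IsCompact b) (hb' : IsOpen b) :
    IsClopen {A : ClosedAddSubgroup G | ((A : Set G) ∩ b).Nonempty} := by
  refine ⟨⟨?_⟩, isOpen_setOf_inter_nonempty hb'⟩
  convert isOpen_setOf_inter_eq_empty hb using 1
  ext A
  simp [Set.not_nonempty_iff_eq_empty]

/-- The space of closed subgroups is compact: the limit of an ultrafilter `F` consists of the points
all of whose neighbourhoods meet `F`-almost every subgroup. -/
instance compactSpace {G : Type*} [AddGroup G] [TopologicalSpace G] [IsTopologicalAddGroup G] :
    CompactSpace (ClosedAddSubgroup G) := by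
  refine ⟨isCompact_iff_ultrafilter_le_nhds.2 fun F _ => ?_⟩
  let A : ClosedAddSubgroup G :=
    { carrier := {x | ∀ U : Set G, IsOpen U → x ∈ U →
        {H : ClosedAddSubgroup G | ((H : Set G) ∩ U).Nonempty} ∈ F}
      zero_mem' := fun U _ h0 => Filter.univ_mem' fun H => ⟨0, zero_mem H, h0⟩
      add_mem' := by
        intro x y hx hy U hU hxy
        obtain ⟨V, W, hV, hW, hxV, hyW, hVW⟩ := isOpen_prod_iff.1
          (hU.preimage continuous_add) x y hxy
        filter_upwards [hx V hV hxV, hy W hW hyW]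
        rintro H ⟨a, haH, haV⟩ ⟨b, hbH, hbW⟩
        exact ⟨a + b, add_mem haH hbH, hVW (Set.mk_mem_prod haV hbW)⟩
      neg_mem' := by
        intro x hx U hU hxU
        filter_upwards [hx (-U) hU.neg (by simpa using hxU)]
        rintro H ⟨a, haH, haU⟩
        exact ⟨-a, neg_mem haH, haU⟩
      isClosed' := by
        refine isClosed_of_closure_subset fun x hx U hU hxU => ?_
        obtain ⟨y, hyU, hy⟩ := mem_closure_iff.1 hx U hU hxU
        exact hy U hU hyU }
  have hA : ∀ x, x ∈ A ↔ ∀ U : Set G, IsOpen U → x ∈ U →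
        {H : ClosedAddSubgroup G | ((H : Set G) ∩ U).Nonempty} ∈ F := fun x => Iff.rfl
  refine ⟨A, trivial, ?_⟩
  rw [TopologicalSpace.nhds_generateFrom]
  refine le_iInf₂ fun S hS => ?_
  rw [le_principal_iff]
  obtain ⟨hAS, ⟨K, hK, rfl⟩ | ⟨U, hU, rfl⟩⟩ := hS
  · have hAK : ∀ x ∈ K, ∃ U, IsOpen U ∧ x ∈ U ∧
        {H : ClosedAddSubgroup G | (H : Set G) ∩ U = ∅} ∈ F := by
      intro x hx
      have : x ∉ A := fun h => by
        have : x ∈ (A : Set G) ∩ K := ⟨h, hx⟩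
        rw [hAS] at this
        exact this
      rw [hA] at this
      push Not at this
      obtain ⟨U, hU, hxU, h⟩ := this
      refine ⟨U, hU, hxU, ?_⟩
      have := Ultrafilter.compl_mem_iff_notMem.2 h
      convert this using 1
      ext H
      simp [Set.not_nonempty_iff_eq_empty]
    -- Each point of `K` has a neighbourhood missed by `F`-almost every subgroup; finitely many of
    -- these cover `K`.
    refine hK.induction_on (p := fun K => {H : ClosedAddSubgroup G | (H : Set G) ∩ K = ∅} ∈ F)
      (Filter.univ_mem' fun H => Set.inter_empty _) ?_ ?_ ?_
    · intro s t hst ht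
      filter_upwards [ht] with H hH
      exact Set.subset_eq_empty (Set.inter_subset_inter_right _ hst) hH
    · intro s t hs ht
      filter_upwards [hs, ht] with H h1 h2
      change (H : Set G) ∩ s = ∅ at h1
      change (H : Set G) ∩ t = ∅ at h2
      rw [Set.inter_union_distrib_left, h1, h2, Set.union_empty]
    · intro x hx
      obtain ⟨U, hU, hxU, h⟩ := hAK x hx
      exact ⟨U, mem_nhdsWithin_of_mem_nhds (hU.mem_nhds hxU), h⟩
  · obtain ⟨x, hxA, hxU⟩ := hAS
    exact hxA U hU hxU

/-- Closed subgroups are separated by the compact open sets they meet, as soon as these form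
a basis of the topology. -/
theorem exists_inter_nonempty_ne {G : Type*} [AddGroup G] [TopologicalSpace G] {B : Set (Set G)}
    (hB : TopologicalSpace.IsTopologicalBasis B) {H H' : ClosedAddSubgroup G} (h : H ≠ H') :
    ∃ b ∈ B, ¬ (((H : Set G) ∩ b).Nonempty ↔ ((H' : Set G) ∩ b).Nonempty) := by
  have key : ∀ H H' : ClosedAddSubgroup G, ¬ (H : Set G) ⊆ H' →
      ∃ b ∈ B, ¬ (((H : Set G) ∩ b).Nonempty ↔ ((H' : Set G) ∩ b).Nonempty) := by
    intro H H' h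
    obtain ⟨x, hx, hx'⟩ := Set.not_subset.1 h
    obtain ⟨b, hb, hxb, hbs⟩ := hB.exists_subset_of_mem_open (u := (H' : Set G)ᶜ) hx'
      H'.isClosed'.isOpen_compl
    refine ⟨b, hb, fun hiff => ?_⟩
    obtain ⟨y, hy, hyb⟩ := hiff.1 ⟨x, hx, hxb⟩
    exact hbs hyb hy
  by_cases h1 : (H : Set G) ⊆ H'
  · have h2 : ¬ (H' : Set G) ⊆ H := fun h2 => h (SetLike.coe_injective (h1.antisymm h2))
    obtain ⟨b, hb, hne⟩ := key _ _ h2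
    exact ⟨b, hb, fun hiff => hne hiff.symm⟩
  · exact key _ _ h1

open Classical in
-- Recording which members of a compact open basis are met maps the Chabauty space into a Cantor
-- cube; separation and metrizability are inherited from there.
theorem continuous_decide_inter_nonempty {G : Type*} [AddGroup G] [TopologicalSpace G]
    {B : Set (Set G)} (hc : ∀ b ∈ B, IsCompact b) (ho : ∀ b ∈ B, IsOpen b) :
    Continuous fun (H : ClosedAddSubgroup G) (b : B) => decide ((H : Set G) ∩ b).Nonempty :=
  continuous_pi fun b => by
    have := isClopen_setOf_inter_nonempty (hc b b.2) (ho b b.2)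
    exact (IsLocallyConstant.iff_continuous _).1 (IsLocallyConstant.iff_exists_open _ |>.2 fun H => by
      by_cases hH : ((H : Set G) ∩ b).Nonempty
      · exact ⟨_, this.2, hH, fun H' hH' => by
          have hH' : ((H' : Set G) ∩ b).Nonempty := hH'
          simp [hH, hH']⟩
      · exact ⟨_, this.1.isOpen_compl, hH, fun H' hH' => by
          have hH' : ¬ ((H' : Set G) ∩ b).Nonempty := hH'
          simp [hH, hH']⟩)

open Classical in
theorem injective_decide_inter_nonempty {G : Type*} [AddGroup G] [TopologicalSpace G]
    {B : Set (Set G)} (hB : TopologicalSpace.IsTopologicalBasis B) :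
    Function.Injective
      fun (H : ClosedAddSubgroup G) (b : B) => decide ((H : Set G) ∩ b).Nonempty := by
  intro H H' h
  by_contra hne
  obtain ⟨b, hb, hiff⟩ := exists_inter_nonempty_ne hB hne
  exact hiff (by simpa using congrFun h ⟨b, hb⟩)

theorem t2Space_of_basis {G : Type*} [AddGroup G] [TopologicalSpace G] {B : Set (Set G)}
    (hB : TopologicalSpace.IsTopologicalBasis B) (hc : ∀ b ∈ B, IsCompact b) :
    T2Space (ClosedAddSubgroup G) :=
  T2Space.of_injective_continuous (injective_decide_inter_nonempty hB)
    (continuous_decide_inter_nonempty hc fun _ hb => hB.isOpen hb)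

theorem metrizableSpace_of_countable_basis {G : Type*} [AddGroup G] [TopologicalSpace G]
    [IsTopologicalAddGroup G] {B : Set (Set G)} (hB : TopologicalSpace.IsTopologicalBasis B)
    (hc : ∀ b ∈ B, IsCompact b) (hB' : B.Countable) :
    TopologicalSpace.MetrizableSpace (ClosedAddSubgroup G) :=
  have := hB'.to_subtype
  ((continuous_decide_inter_nonempty hc fun _ hb => hB.isOpen hb).isClosedEmbedding
    (injective_decide_inter_nonempty hB)).isEmbedding.metrizableSpace

/-- A proper separable ultrametric space has a countable basis of compact open sets. -/
theorem _root_.exists_countable_basis_isCompact (X : Type*) [MetricSpace X] [IsUltrametricDist X]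
    [ProperSpace X] :
    ∃ B : Set (Set X), B.Countable ∧ TopologicalSpace.IsTopologicalBasis B ∧
      ∀ b ∈ B, IsCompact b := by
  obtain ⟨s, hs, hd⟩ := TopologicalSpace.exists_countable_dense X
  refine ⟨(fun q : X × ℕ => Metric.closedBall q.1 (1 / (q.2 + 1 : ℝ))) '' (s ×ˢ Set.univ),
    (hs.prod Set.countable_univ).image _, ?_, ?_⟩
  · refine TopologicalSpace.isTopologicalBasis_of_isOpen_of_nhds ?_ ?_
    · rintro _ ⟨⟨x, k⟩, -, rfl⟩
      exact IsUltrametricDist.isOpen_closedBall _ (by positivity)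
    · intro x U hxU hU
      obtain ⟨ε, hε, hεU⟩ := Metric.isOpen_iff.1 hU x hxU
      obtain ⟨k, hk⟩ := exists_nat_one_div_lt hε
      obtain ⟨y, hys, hy⟩ := hd.exists_dist_lt x (ε := 1 / ((k : ℝ) + 1)) (by positivity)
      refine ⟨_, ⟨⟨y, k⟩, ⟨hys, trivial⟩, rfl⟩, Metric.mem_closedBall.2 hy.le, fun z hz => hεU ?_⟩
      have := dist_triangle_max z y x
      rw [dist_comm y x] at this
      exact Metric.mem_ball.2 (this.trans_lt (max_lt (hz.trans_lt hk) (hy.trans hk)))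
  · rintro _ ⟨⟨x, k⟩, -, rfl⟩
    exact isCompact_closedBall _ _

/-- The image of a closed subgroup under a closed embedding of groups. -/
def mapClosedEmbedding {A G : Type*} [AddGroup A] [TopologicalSpace A] [AddGroup G]
    [TopologicalSpace G] (f : A →+ G) (hf : IsClosedEmbedding f) (H : ClosedAddSubgroup A) :
    ClosedAddSubgroup G where
  toAddSubgroup := H.toAddSubgroup.map f
  isClosed' := hf.isClosedMap _ H.isClosed'

theorem coe_mapClosedEmbedding {A G : Type*} [AddGroup A] [TopologicalSpace A] [AddGroup G]
    [TopologicalSpace G] (f : A →+ G) (hf : IsClosedEmbedding f) (H : ClosedAddSubgroup A) :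
    (H.mapClosedEmbedding f hf : Set G) = f '' (H : Set A) := rfl

/-- Preimages of compact sets under a closed embedding are compact, which gives continuity; a
continuous injection from a compact space to a Hausdorff space is an embedding. -/
theorem isEmbedding_mapClosedEmbedding {A G : Type*} [AddGroup A] [TopologicalSpace A]
    [IsTopologicalAddGroup A] [AddGroup G] [TopologicalSpace G] [T2Space (ClosedAddSubgroup G)]
    (f : A →+ G) (hf : IsClosedEmbedding f) :
    IsEmbedding (mapClosedEmbedding f hf) := by
  have hc : Continuous (mapClosedEmbedding f hf) := by
    refine continuous_generateFrom_iff.2 ?_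
    rintro S (⟨K, hK, rfl⟩ | ⟨U, hU, rfl⟩)
    · convert isOpen_setOf_inter_eq_empty (hf.isCompact_preimage hK) using 1
      ext H
      simp only [Set.mem_preimage, Set.mem_ofPred_eq, coe_mapClosedEmbedding]
      rw [← Set.image_inter_preimage, Set.image_eq_empty]
    · convert isOpen_setOf_inter_nonempty (hU.preimage hf.continuous) using 1
      ext H
      simp only [Set.mem_preimage, Set.mem_ofPred_eq, coe_mapClosedEmbedding]
      rw [← Set.image_inter_preimage, Set.image_nonempty]
  refine (hc.isClosedEmbedding fun H H' h => ?_).isEmbedding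
  apply SetLike.coe_injective
  exact hf.injective.image_injective (congrArg (fun K : ClosedAddSubgroup G => (K : Set G)) h)

end ClosedAddSubgroup

/-! ### Expansive homeomorphisms and clopen sets -/

theorem Homeomorph.semiconj_zpow {X Y : Type*} [TopologicalSpace X] [TopologicalSpace Y]
    {φ : X ≃ₜ X} {ψ : Y ≃ₜ Y} {F : X → Y} (h : ∀ x, F (φ x) = ψ (F x)) (n : ℤ) (x : X) :
    F ((φ ^ n) x) = (ψ ^ n) (F x) := by
  induction n generalizing x with
  | zero => rfl
  | succ n ih =>
    rw [zpow_add_one, zpow_add_one, Homeomorph.mul_apply, Homeomorph.mul_apply, ih, h]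
  | pred n ih =>
    rw [zpow_sub_one, zpow_sub_one, Homeomorph.mul_apply, Homeomorph.mul_apply, ih]
    congr 1
    change F (φ.symm x) = ψ.symm (F x)
    rw [← ψ.symm_apply_apply (F (φ.symm x)), ← h, φ.apply_symm_apply]

theorem IsExpansiveHomeo.of_isEmbedding {X Y : Type*} [tX : TopologicalSpace X]
    [tY : TopologicalSpace Y] {φ : X ≃ₜ X} {ψ : Y ≃ₜ Y} {F : X → Y} (hF : IsEmbedding F)
    (h : ∀ x, F (φ x) = ψ (F x)) (hψ : IsExpansiveHomeo ψ) : IsExpansiveHomeo φ := by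
  obtain ⟨d, hd, δ, hδ, H⟩ := hψ
  subst hd
  refine ⟨MetricSpace.induced F hF.injective d, hF.eq_induced.symm, δ, hδ, fun x y hxy => ?_⟩
  obtain ⟨n, hn⟩ := H (F x) (F y) (hF.injective.ne hxy)
  rw [← Homeomorph.semiconj_zpow h, ← Homeomorph.semiconj_zpow h] at hn
  exact ⟨n, hn⟩

/-- On a compact space, an expansive homeomorphism separates the points through finitely many
members of any given separating family of clopen sets. -/
theorem IsExpansiveHomeo.exists_finset {X : Type*} [t : TopologicalSpace X] [CompactSpace X]
    {φ : X ≃ₜ X} (hφ : IsExpansiveHomeo φ) {S : Set (Set X)} (hS : ∀ s ∈ S, IsClopen s)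
    (hsep : ∀ x y : X, x ≠ y → ∃ s ∈ S, ¬ (x ∈ s ↔ y ∈ s)) :
    ∃ F : Set (Set X), F ⊆ S ∧ F.Finite ∧
      ∀ x y : X, x ≠ y → ∃ n : ℤ, ∃ s ∈ F, ¬ ((φ ^ n) x ∈ s ↔ (φ ^ n) y ∈ s) := by
  obtain ⟨d, hd, δ, hδ, H⟩ := hφ
  subst hd
  -- The pairs at distance at least `δ` form a compact set, covered by the open sets of pairs that
  -- some `s ∈ S` separates.
  have hK : IsCompact {q : X × X | δ ≤ dist q.1 q.2} :=
    (isClosed_le continuous_const continuous_dist).isCompact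
  have ho : ∀ s ∈ S, IsOpen {q : X × X | ¬ (q.1 ∈ s ↔ q.2 ∈ s)} := by
    intro s hs
    have : {q : X × X | ¬ (q.1 ∈ s ↔ q.2 ∈ s)} = s ×ˢ sᶜ ∪ sᶜ ×ˢ s := by
      ext q
      simp only [Set.mem_union, Set.mem_prod, Set.mem_compl_iff, Set.mem_ofPred_eq]
      tauto
    rw [this]
    exact ((hS s hs).isOpen.prod (hS s hs).compl.isOpen).union
      ((hS s hs).compl.isOpen.prod (hS s hs).isOpen)
  obtain ⟨F, hFS, hF, hcov⟩ := hK.elim_finite_subcover_image ho (by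
    rintro ⟨x, y⟩ hxy
    have hxy : δ ≤ dist x y := hxy
    obtain ⟨s, hs, h⟩ := hsep x y (dist_pos.1 (hδ.trans_le hxy))
    exact Set.mem_biUnion hs h)
  refine ⟨F, hFS, hF, fun x y hxy => ?_⟩
  obtain ⟨n, hn⟩ := H x y hxy
  have : ((φ ^ n) x, (φ ^ n) y) ∈ {q : X × X | δ ≤ dist q.1 q.2} := hn.le
  obtain ⟨s, hs, h⟩ := Set.mem_iUnion₂.1 (hcov this)
  exact ⟨n, s, hs, h⟩

/-- A homeomorphism of a compact metrizable space that separates points through finitely many clopen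
sets is expansive. -/
theorem IsExpansiveHomeo.of_isClopen {X ι : Type*} [t : TopologicalSpace X] [CompactSpace X]
    [TopologicalSpace.MetrizableSpace X] [Finite ι] {φ : X ≃ₜ X} {s : ι → Set X}
    (hs : ∀ i, IsClopen (s i))
    (hsep : ∀ x y : X, x ≠ y → ∃ n : ℤ, ∃ i, ¬ ((φ ^ n) x ∈ s i ↔ (φ ^ n) y ∈ s i)) :
    IsExpansiveHomeo φ := by
  let := Fintype.ofFinite ι
  let d := TopologicalSpace.metrizableSpaceMetric X
  -- By compactness, a clopen set has positive distance from its complement.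
  have hloc : ∀ i, ∃ ε > 0, ∀ x y : X, dist x y < ε → x ∈ s i → y ∈ s i := by
    intro i
    obtain ⟨ε, hε, h⟩ := (hs i).isClosed.isCompact.exists_thickening_subset_open (hs i).isOpen
      subset_rfl
    exact ⟨ε, hε, fun x y hxy hx => h (Metric.mem_thickening_iff.2 ⟨x, hx, by rwa [dist_comm]⟩)⟩
  choose ε hε h using hloc
  obtain ⟨δ, hδ, hδε⟩ : ∃ δ > 0, ∀ i, δ ≤ ε i := by
    rcases isEmpty_or_nonempty ι with _ | _
    · exact ⟨1, one_pos, fun i => isEmptyElim i⟩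
    · exact ⟨Finset.univ.inf' Finset.univ_nonempty ε, by simpa using hε,
        fun i => Finset.inf'_le _ (Finset.mem_univ i)⟩
  refine ⟨d, rfl, δ / 2, half_pos hδ, fun x y hxy => ?_⟩
  obtain ⟨n, i, hn⟩ := hsep x y hxy
  refine ⟨n, not_le.1 fun hle => hn ?_⟩
  have hlt : dist ((φ ^ n) x) ((φ ^ n) y) < ε i :=
    (hle.trans_lt (half_lt_self hδ)).trans_le (hδε i)
  exact ⟨h i _ _ hlt, h i _ _ (by rwa [dist_comm])⟩

/-! ### Iterates and integer powers of an automorphism -/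

section Iterate

variable {G : Type*} [AddCommGroup G] [TopologicalSpace G]

theorem ContinuousAddEquiv.continuous_iterate (T : G ≃ₜ+ G) (k : ℕ) : Continuous T^[k] :=
  T.continuous_toFun.iterate k

theorem ContinuousAddEquiv.toHomeomorph_zpow_natCast (T : G ≃ₜ+ G) (k : ℕ) (x : G) :
    (T.toHomeomorph ^ (k : ℤ)) x = T^[k] x := by
  induction k generalizing x with
  | zero => rfl
  | succ k ih =>
    rw [Nat.cast_succ, zpow_add_one, Homeomorph.mul_apply, ih]
    rfl

theorem ContinuousAddEquiv.toHomeomorph_zpow_neg_natCast (T : G ≃ₜ+ G) (k : ℕ) (x : G) :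
    (T.toHomeomorph ^ (-k : ℤ)) x = T.symm^[k] x := by
  rw [← T.symm.toHomeomorph_zpow_natCast, zpow_neg, ← inv_zpow]
  rfl

end Iterate

/-! ### Expansive automorphisms commuting with a contraction -/

section Contraction

variable {G : Type*} [NormedAddCommGroup G]

theorem ContinuousAddEquiv.norm_iterate_le {σ : G ≃ₜ+ G} {c : ℝ} (hc : 0 ≤ c)
    (hσ : ∀ x, ‖σ x‖ ≤ c * ‖x‖) (k : ℕ) (x : G) : ‖σ^[k] x‖ ≤ c ^ k * ‖x‖ := by
  induction k with
  | zero => simp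
  | succ k ih =>
    rw [Function.iterate_succ_apply', pow_succ']
    calc _ ≤ c * ‖σ^[k] x‖ := hσ _
      _ ≤ c * (c ^ k * ‖x‖) := by gcongr
      _ = _ := by ring

/-- If `T` is expansive and commutes with a contraction, then no nonzero point has a bounded
two-sided orbit. -/
theorem IsExpansiveAut.eq_zero_of_bounded {T σ : G ≃ₜ+ G} (hT : IsExpansiveAut T) {c : ℝ}
    (hc : 0 ≤ c) (hc1 : c < 1) (hσ : ∀ x, ‖σ x‖ ≤ c * ‖x‖) (hcomm : ∀ x, σ (T x) = T (σ x))
    {R : ℝ} {x : G} (hx : ∀ n, ‖T^[n] x‖ ≤ R) (hx' : ∀ n, ‖T.symm^[n] x‖ ≤ R) : x = 0 := by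
  obtain ⟨U, hU, h⟩ := hT
  obtain ⟨ε, hε, hεU⟩ := Metric.mem_nhds_iff.1 hU
  have hlim : Tendsto (fun k : ℕ => c ^ k * R) atTop (𝓝 0) := by
    simpa using (tendsto_pow_atTop_nhds_zero_of_lt_one hc hc1).mul_const R
  -- For this `k` the whole orbit of `σ^[k] x` stays in `U`, so expansiveness forces it to be zero.
  obtain ⟨k, hk⟩ := (hlim.eventually (gt_mem_nhds hε)).exists
  have hbd : ∀ n : ℤ, ‖(T.toHomeomorph ^ n) x‖ ≤ R := by
    intro n
    obtain ⟨n, rfl | rfl⟩ := n.eq_nat_or_neg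
    · rw [T.toHomeomorph_zpow_natCast]; exact hx n
    · rw [T.toHomeomorph_zpow_neg_natCast]; exact hx' n
  have hmem : σ^[k] x ∈ ⋂ n : ℤ, (T.toHomeomorph ^ n) '' U := by
    refine Set.mem_iInter.2 fun n => ⟨(T.toHomeomorph ^ (-n)) (σ^[k] x), hεU ?_, ?_⟩
    · have hcommk : ∀ y, σ^[k] (T.toHomeomorph y) = T.toHomeomorph (σ^[k] y) := by
        intro y
        exact (Function.Commute.iterate_left (f := σ) (g := T) hcomm k) y
      rw [← Homeomorph.semiconj_zpow hcommk, mem_ball_zero_iff]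
      refine (ContinuousAddEquiv.norm_iterate_le hc hσ k _).trans_lt (lt_of_le_of_lt ?_ hk)
      exact mul_le_mul_of_nonneg_left (hbd _) (pow_nonneg hc k)
    · rw [← Homeomorph.mul_apply, ← zpow_add, add_neg_cancel, zpow_zero, Homeomorph.one_apply]
  rw [h, Set.mem_singleton_iff, ← iterate_map_zero σ k] at hmem
  exact σ.injective.iterate k hmem

theorem ContinuousAddEquiv.symm_iterate_iterate (T : G ≃ₜ+ G) (k : ℕ) (x : G) :
    T.symm^[k] (T^[k] x) = x :=
  (Function.LeftInverse.iterate (T.symm_apply_apply) k) x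

/-- If no nonzero point has a bounded two-sided orbit, then bounded forward orbits tend to `0`. -/
theorem tendsto_iterate_of_bounded [ProperSpace G] {T : G ≃ₜ+ G}
    (h0 : ∀ (R : ℝ) (x : G), (∀ n, ‖T^[n] x‖ ≤ R) → (∀ n, ‖T.symm^[n] x‖ ≤ R) → x = 0)
    {R : ℝ} {x : G} (hx : ∀ n, ‖T^[n] x‖ ≤ R) :
    Tendsto (fun n => T^[n] x) atTop (𝓝 0) := by
  -- A cluster point of the forward orbit has a two-sided orbit bounded by `R`: for `n ≥ k`, the
  -- `k`-th backward iterate of `T^[n] x` is still on the forward orbit.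
  refine (isCompact_closedBall (0 : G) R).tendsto_nhds_of_unique_mapClusterPt
    (Eventually.of_forall fun n => by simpa using hx n) fun y _ hy => h0 R y ?_ ?_
  · intro k
    have h1 : MapClusterPt (T^[k] y) atTop (T^[k] ∘ fun n => T^[n] x) :=
      hy.continuousAt_comp (T.continuous_iterate k).continuousAt
    have := isClosed_closedBall (x := (0 : G)) (ε := R) |>.mem_of_mapClusterPt h1
      (Eventually.of_forall fun n => by
        simpa [← Function.iterate_add_apply] using hx (k + n))
    simpa using this
  · intro k
    have h1 : MapClusterPt (T.symm^[k] y) atTop (T.symm^[k] ∘ fun n => T^[n] x) :=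
      hy.continuousAt_comp (T.symm.continuous_iterate k).continuousAt
    have := isClosed_closedBall (x := (0 : G)) (ε := R) |>.mem_of_mapClusterPt h1
      ((eventually_ge_atTop k).mono fun n hn => by
        obtain ⟨j, rfl⟩ := Nat.exists_eq_add_of_le hn
        simpa [Function.iterate_add_apply, T.symm_iterate_iterate] using hx j)
    simpa using this

theorem norm_sub_le_one {x y : G} [IsUltrametricDist G] (hx : ‖x‖ ≤ 1) (hy : ‖y‖ ≤ 1) :
    ‖x - y‖ ≤ 1 := by
  rw [sub_eq_add_neg]
  exact (IsUltrametricDist.norm_add_le_max _ _).trans (max_le hx (by rwa [norm_neg]))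

/-- Near `0`, every element is the sum of one with backward orbit in the unit ball and one with
forward orbit in the unit ball (the tidying procedure for the unit ball). -/
theorem exists_nhds_forall_exists_add_eq [IsUltrametricDist G] [ProperSpace G] (T : G ≃ₜ+ G) :
    ∃ V ∈ 𝓝 (0 : G), ∀ x ∈ V, ∃ y z, y + z = x ∧ (∀ k, ‖T.symm^[k] y‖ ≤ 1) ∧
      ∀ k, ‖T^[k] z‖ ≤ 1 := by
  have hsub : ∀ (S : G ≃ₜ+ G) (k : ℕ) (x y : G), ‖S^[k] x‖ ≤ 1 → ‖S^[k] y‖ ≤ 1 →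
      ‖S^[k] (x - y)‖ ≤ 1 := fun S k x y hx hy => by
    rw [iterate_map_sub]
    exact norm_sub_le_one hx hy
  have hcont : ∀ (S : G ≃ₜ+ G) (k : ℕ), Continuous fun x => ‖S^[k] x‖ := fun S k =>
    continuous_norm.comp (S.continuous_iterate k)
  let L : ℕ → Set G := fun n => {x | ∀ k ≤ n, ‖T.symm^[k] x‖ ≤ 1}
  let P : Set G := {x | ∀ k, ‖T.symm^[k] x‖ ≤ 1}
  have hLcl : ∀ n, IsClosed (L n) := fun n => by
    simp only [L, Set.ofPred_forall]
    exact isClosed_iInter fun k => isClosed_iInter fun _ => isClosed_le (hcont _ k) continuous_const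
  have hPcl : IsClosed P := by
    simp only [P, Set.ofPred_forall]
    exact isClosed_iInter fun k => isClosed_le (hcont _ k) continuous_const
  have hLc : ∀ n, IsCompact (L n) := fun n =>
    (isCompact_closedBall (0 : G) 1).of_isClosed_subset (hLcl n) fun x hx => by
      simpa using hx 0 (Nat.zero_le n)
  have hPc : IsCompact P := (isCompact_closedBall (0 : G) 1).of_isClosed_subset hPcl fun x hx => by
      simpa using hx 0
  have hopen : IsOpen (P + {w | ‖T w‖ ≤ 1}) := by
    refine IsOpen.add_left ?_
    have := (IsUltrametricDist.isOpen_closedBall (0 : G) one_ne_zero).preimage T.continuous_toFun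
    convert this using 1
    ext w
    simp only [Set.mem_preimage, mem_closedBall_zero_iff]
    rfl
  -- The compact sets `L n` decrease to `P`, which lies in this open set.
  obtain ⟨n, hn⟩ : ∃ n, L n ⊆ P + {w | ‖T w‖ ≤ 1} := by
    have hanti : Antitone L := fun i j hij x hx k hk => hx k (hk.trans hij)
    refine exists_subset_nhds_of_isCompact hanti.directed_ge hLc fun x hx => ?_
    refine hopen.mem_nhds ⟨x, fun k => Set.mem_iInter.1 hx k k le_rfl, 0, by simp, by simp⟩
  have hTsymm : ∀ y k, T.symm^[k + 1] (T y) = T.symm^[k] y := fun y k => by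
    rw [Function.iterate_succ_apply, T.symm_apply_apply]
  have hsplit : ∀ x ∈ L n, ∃ y ∈ P, T (x - y) ∈ L n := by
    intro x hx
    obtain ⟨y, hy, w, hw, rfl⟩ := hn hx
    refine ⟨y, hy, ?_⟩
    rintro (_ | k) hk
    · simpa using hw
    · rw [hTsymm]
      exact hsub _ _ _ _ (hx k (by omega)) (hy k)
  have hfin : ∀ (k : ℕ), ∀ x ∈ L n, ∃ y ∈ P, ∀ j ≤ k, T^[j] (x - y) ∈ L n := by
    intro k
    induction k with
    | zero =>
      intro x hx
      refine ⟨0, fun k => by simp [iterate_map_zero], fun j hj => ?_⟩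
      obtain rfl : j = 0 := by omega
      simpa using hx
    | succ k ih =>
      intro x hx
      obtain ⟨y, hy, hxy⟩ := hsplit x hx
      obtain ⟨z, hz, h⟩ := ih _ hxy
      -- The correction `z` found for `T (x - y)` is pulled back by `T.symm`, which preserves `P`.
      have hyz : y + T.symm z ∈ P := by
        intro i
        rw [iterate_map_add]
        refine (IsUltrametricDist.norm_add_le_max _ _).trans (max_le (hy i) ?_)
        rw [← Function.iterate_succ_apply]
        exact hz (i + 1)
      refine ⟨_, hyz, ?_⟩
      rintro (_ | j) hj
      · exact fun i hi => hsub _ _ _ _ (hx i hi) (hyz i)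
      · have := h j (by omega)
        rw [Function.iterate_succ_apply]
        convert this using 2
        simp only [map_sub, map_add, T.apply_symm_apply]
        abel
  refine ⟨L n, ?_, fun x hx => ?_⟩
  · refine (Set.finite_Iic n).eventually_all.2 ?_ |>.mono fun x hx k hk => hx k hk
    intro k _
    refine ((hcont T.symm k).tendsto 0).eventually_le_const ?_
    simp [iterate_map_zero]
  -- Compactness of `P` yields one `y` valid for all `k` from those valid up to each `k`.
  · have hne : (⋂ k : ℕ, {y | y ∈ P ∧ ∀ j ≤ k, ‖T^[j] (x - y)‖ ≤ 1}).Nonempty := by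
      have hcl : ∀ k : ℕ, IsClosed {y | y ∈ P ∧ ∀ j ≤ k, ‖T^[j] (x - y)‖ ≤ 1} := by
        intro k
        refine hPcl.inter (s₂ := {y | ∀ j ≤ k, ‖T^[j] (x - y)‖ ≤ 1}) ?_
        simp only [Set.ofPred_forall]
        exact isClosed_iInter fun j => isClosed_iInter fun _ =>
          isClosed_le ((hcont T j).comp (continuous_const.sub continuous_id)) continuous_const
      refine IsCompact.nonempty_iInter_of_sequence_nonempty_isCompact_isClosed _ ?_ ?_ ?_ hcl
      · exact fun k y hy => ⟨hy.1, fun j hj => hy.2 j (hj.trans k.le_succ)⟩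
      · intro k
        obtain ⟨y, hy, h⟩ := hfin k x hx
        exact ⟨y, hy, fun j hj => h j hj 0 (Nat.zero_le n)⟩
      · exact hPc.of_isClosed_subset (hcl 0) fun y hy => hy.1
    obtain ⟨y, hy⟩ := hne
    have hy := fun k => Set.mem_iInter.1 hy k
    exact ⟨y, x - y, by abel, (hy 0).1, fun k => (hy k).2 k le_rfl⟩

/-- A group on which an expansive automorphism `T` commutes with a contraction is the direct product
of the contraction groups of `T` and of its inverse. -/
theorem IsExpansiveAut.isInternalDirectProduct [IsUltrametricDist G] [ProperSpace G]
    {T σ : G ≃ₜ+ G} (hT : IsExpansiveAut T) {c : ℝ} (hc : 0 ≤ c) (hc1 : c < 1)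
    (hσ : ∀ x, ‖σ x‖ ≤ c * ‖x‖) (hcomm : ∀ x, σ (T x) = T (σ x)) :
    IsInternalDirectProduct (contractionGroup T) (contractionGroup T.symm) := by
  have hcomm' : ∀ x, σ (T.symm x) = T.symm (σ x) := fun x => by
    rw [ContinuousAddEquiv.eq_symm_apply, ← hcomm, T.apply_symm_apply]
  have h0 : ∀ (R : ℝ) (x : G), (∀ n, ‖T^[n] x‖ ≤ R) → (∀ n, ‖T.symm^[n] x‖ ≤ R) → x = 0 :=
    fun R x => hT.eq_zero_of_bounded hc hc1 hσ hcomm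
  have hbdd : ∀ (S : G ≃ₜ+ G) (x : G), x ∈ contractionGroup S → ∃ R, ∀ n, ‖S^[n] x‖ ≤ R := by
    intro S x hx
    obtain ⟨R, hR⟩ := (Metric.isBounded_range_of_tendsto _ hx).exists_norm_le
    exact ⟨R, fun n => hR _ ⟨n, rfl⟩⟩
  have hinter : ∀ x, x ∈ contractionGroup T → x ∈ contractionGroup T.symm → x = 0 := by
    intro x hx hx'
    obtain ⟨R, hR⟩ := hbdd T x hx
    obtain ⟨R', hR'⟩ := hbdd T.symm x hx'
    exact h0 (max R R') x (fun n => (hR n).trans (le_max_left _ _))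
      fun n => (hR' n).trans (le_max_right _ _)
  have hmem : ∀ (R : ℝ) (x : G), (∀ n, ‖T^[n] x‖ ≤ R) → x ∈ contractionGroup T :=
    fun R x hx => tendsto_iterate_of_bounded h0 hx
  have hmem' : ∀ (R : ℝ) (x : G), (∀ n, ‖T.symm^[n] x‖ ≤ R) → x ∈ contractionGroup T.symm :=
    fun R x hx => tendsto_iterate_of_bounded (T := T.symm) (fun R x h h' => h0 R x h' h) hx
  obtain ⟨V, hV, hdec⟩ := exists_nhds_forall_exists_add_eq T
  have hlim : Tendsto (fun k : ℕ => c ^ k) atTop (𝓝 0) := tendsto_pow_atTop_nhds_zero_of_lt_one hc hc1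
  let f : (contractionGroup T × contractionGroup T.symm) →+ G :=
    (contractionGroup T).subtype.coprod (contractionGroup T.symm).subtype
  have hf : ∀ a, f a = (a.1 : G) + a.2 := fun a => rfl
  have hinj : Function.Injective f := by
    refine (injective_iff_map_eq_zero f).2 fun a ha => ?_
    rw [hf] at ha
    have h2 : (a.1 : G) = 0 := by
      refine hinter _ a.1.2 ?_
      rw [eq_neg_of_add_eq_zero_left ha]
      exact neg_mem a.2.2
    have h3 : (a.2 : G) = 0 := by rwa [h2, zero_add] at ha
    exact Prod.ext (Subtype.ext h2) (Subtype.ext h3)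
  have hcompact : ∀ k : ℕ, ∃ R, ∀ w : G, ‖w‖ ≤ 1 → ‖σ.symm^[k] w‖ ≤ R := by
    intro k
    obtain ⟨R, hR⟩ := ((isCompact_closedBall (0 : G) 1).image
      (σ.symm.continuous_iterate k)).isBounded.exists_norm_le
    exact ⟨R, fun w hw => hR _ ⟨w, by simpa using hw, rfl⟩⟩
  have hcs : ∀ x, σ.symm (T x) = T (σ.symm x) := fun x => by
    rw [σ.symm_apply_eq, hcomm, σ.apply_symm_apply]
  have hcs' : ∀ x, σ.symm (T.symm x) = T.symm (σ.symm x) := fun x => by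
    rw [σ.symm_apply_eq, hcomm', σ.apply_symm_apply]
  have hsurj : Function.Surjective f := by
    intro x
    have hx : Tendsto (fun k : ℕ => σ^[k] x) atTop (𝓝 0) := by
      refine squeeze_zero_norm (fun k => σ.norm_iterate_le hc hσ k x) ?_
      simpa using hlim.mul_const ‖x‖
    -- Once `σ^[k] x` is in `V` it is decomposed there and carried back by `σ.symm^[k]`, which is
    -- bounded on the unit ball and commutes with `T`, so orbits stay bounded.
    obtain ⟨k, hk⟩ := (hx.eventually hV).exists
    obtain ⟨y, z, hyz, hy, hz⟩ := hdec _ hk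
    obtain ⟨R, hR⟩ := hcompact k
    refine ⟨(⟨σ.symm^[k] z, hmem R _ fun n => ?_⟩, ⟨σ.symm^[k] y, hmem' R _ fun n => ?_⟩), ?_⟩
    · have := (Function.Commute.iterate_iterate (f := T) (g := σ.symm) (fun x => (hcs x).symm) n k) z
      rw [this]
      exact hR _ (hz n)
    · have := (Function.Commute.iterate_iterate (f := T.symm) (g := σ.symm)
        (fun x => (hcs' x).symm) n k) y
      rw [this]
      exact hR _ (hy n)
    · rw [hf]
      change σ.symm^[k] z + σ.symm^[k] y = x
      rw [← iterate_map_add, add_comm z, hyz, σ.symm_iterate_iterate]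
  let e : (contractionGroup T × contractionGroup T.symm) ≃+ G :=
    AddEquiv.ofBijective f ⟨hinj, hsurj⟩
  have he : ∀ a b, e (a, b) = (a : G) + b := fun a b => rfl
  have hcont : Continuous e := by
    change Continuous fun a : contractionGroup T × contractionGroup T.symm => (a.1 : G) + a.2
    fun_prop
  have hcont' : Continuous e.symm := by
    refine continuous_of_continuousAt_zero e.symm.toAddMonoidHom ?_
    change Tendsto e.symm (𝓝 0) (𝓝 (e.symm 0))
    rw [map_zero, Metric.tendsto_nhds]
    intro ε hε
    obtain ⟨k, hk⟩ := (hlim.eventually (gt_mem_nhds hε)).exists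
    -- Here `x` is `σ^[k]` of a point of `V`, so both of its components have norm at most `c ^ k <
    -- ε`.
    have hV' : ∀ᶠ x in 𝓝 (0 : G), σ.symm^[k] x ∈ V := by
      refine ((σ.symm.continuous_iterate k).tendsto 0).eventually ?_
      rwa [iterate_map_zero]
    filter_upwards [hV'] with x hx
    obtain ⟨y, z, hyz, hy, hz⟩ := hdec _ hx
    have hbd : ∀ w : G, ‖w‖ ≤ 1 → ‖σ^[k] w‖ ≤ c ^ k := fun w hw =>
      (σ.norm_iterate_le hc hσ k w).trans (mul_le_of_le_one_right (pow_nonneg hc k) hw)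
    have hz' : σ^[k] z ∈ contractionGroup T := hmem (c ^ k) _ fun n => by
      rw [(Function.Commute.iterate_iterate (f := T) (g := σ) (fun x => (hcomm x).symm) n k) z]
      exact hbd _ (hz n)
    have hy' : σ^[k] y ∈ contractionGroup T.symm := hmem' (c ^ k) _ fun n => by
      rw [(Function.Commute.iterate_iterate (f := T.symm) (g := σ)
        (fun x => (hcomm' x).symm) n k) y]
      exact hbd _ (hy n)
    have hex : e.symm x = (⟨_, hz'⟩, ⟨_, hy'⟩) := by
      rw [AddEquiv.symm_apply_eq, he]
      change x = σ^[k] z + σ^[k] y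
      rw [← iterate_map_add, add_comm z, hyz]
      exact (σ.symm.symm_iterate_iterate k x).symm
    rw [hex, dist_zero_right, Prod.norm_def]
    exact max_lt ((hbd _ (hz 0)).trans_lt hk) ((hbd _ (hy 0)).trans_lt hk)
  exact ⟨{ e with continuous_toFun := hcont, continuous_invFun := hcont' }, he⟩

end Contraction

/-! ### Continuous homomorphisms between `p`-adic vector spaces -/

section Padic

variable {p : ℕ} [Fact p.Prime]

theorem tendsto_pow_smul_zero {V : Type*} [NormedAddCommGroup V] [NormedSpace ℚ_[p] V] (x : V) :
    Tendsto (fun k : ℕ => p ^ k • x) atTop (𝓝 0) := by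
  have : Tendsto (fun k : ℕ => (p : ℚ_[p]) ^ k • x) atTop (𝓝 ((0 : ℚ_[p]) • x)) :=
    (tendsto_pow_atTop_nhds_zero_of_norm_lt_one Padic.norm_p_lt_one).smul_const x
  rw [zero_smul] at this
  refine this.congr fun k => ?_
  rw [← Nat.cast_smul_eq_nsmul ℚ_[p], Nat.cast_pow]

theorem norm_pow_smul_of_ne {q : ℕ} [Fact q.Prime] (hpq : p ≠ q) {W : Type*}
    [NormedAddCommGroup W] [NormedSpace ℚ_[q] W] (k : ℕ) (y : W) : ‖p ^ k • y‖ = ‖y‖ := by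
  rw [← Nat.cast_smul_eq_nsmul ℚ_[q], norm_smul, Nat.cast_pow, norm_pow,
    Padic.norm_natCast_eq_one_iff.2 ((Nat.coprime_primes Fact.out Fact.out).2 hpq.symm),
    one_pow, one_mul]

/-- There are no nonzero continuous homomorphisms between vector spaces over `ℚ_[p]` and `ℚ_[q]`
for distinct primes. -/
theorem AddMonoidHom.apply_eq_zero_of_prime_ne {q : ℕ} [Fact q.Prime] (hpq : p ≠ q) {V W : Type*}
    [NormedAddCommGroup V] [NormedSpace ℚ_[p] V] [NormedAddCommGroup W] [NormedSpace ℚ_[q] W]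
    (f : V →+ W) (hf : Continuous f) (x : V) : f x = 0 := by
  have h := ((hf.tendsto 0).comp (tendsto_pow_smul_zero (p := p) x)).norm
  rw [map_zero, norm_zero] at h
  have h' : Tendsto (fun _ : ℕ => ‖f x‖) atTop (𝓝 0) := by
    refine h.congr fun k => ?_
    simp only [Function.comp_apply, map_nsmul]
    exact norm_pow_smul_of_ne hpq k _
  exact norm_eq_zero.1 (tendsto_nhds_unique tendsto_const_nhds h')

/-- Additivity gives linearity over `ℚ`, which is dense in `ℚ_[p]`. -/
theorem AddMonoidHom.map_padic_smul {V W : Type*} [NormedAddCommGroup V] [NormedSpace ℚ_[p] V]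
    [NormedAddCommGroup W] [NormedSpace ℚ_[p] W] (f : V →+ W) (hf : Continuous f) (c : ℚ_[p])
    (x : V) : f (c • x) = c • f x := by
  refine isClosed_property (p := fun c : ℚ_[p] => f (c • x) = c • f x)
    (Padic.denseRange_ratCast p) ?_ (fun q => map_ratCast_smul f ℚ_[p] ℚ_[p] q x) c
  exact isClosed_eq (hf.comp (continuous_id.smul continuous_const))
    (continuous_id.smul continuous_const)

end Padic

/-! ### Block-diagonal form of automorphisms -/

section Component

variable {ι : Type*} {p : ι → ℕ} [∀ i, Fact (p i).Prime]
  {M : ι → Type*} [∀ i, NormedAddCommGroup (M i)] [∀ i, NormedSpace ℚ_[p i] (M i)]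

variable (p M) in
/-- Multiplication by `p i` on the `i`-th factor, for all `i`. -/
noncomputable def primeScaling : (∀ i, M i) ≃ₜ+ (∀ i, M i) where
  toFun x i := (p i : ℚ_[p i]) • x i
  invFun x i := (p i : ℚ_[p i])⁻¹ • x i
  left_inv x := funext fun i => inv_smul_smul₀ (Nat.cast_ne_zero.2 (NeZero.ne (p i))) _
  right_inv x := funext fun i => smul_inv_smul₀ (Nat.cast_ne_zero.2 (NeZero.ne (p i))) _
  map_add' x y := funext fun i => smul_add _ _ _
  continuous_toFun := by fun_prop
  continuous_invFun := by fun_prop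

theorem norm_primeScaling_le [Fintype ι] (x : ∀ i, M i) : ‖primeScaling p M x‖ ≤ 2⁻¹ * ‖x‖ := by
  refine (pi_norm_le_iff_of_nonneg (by positivity)).2 fun i => ?_
  change ‖(p i : ℚ_[p i]) • x i‖ ≤ _
  rw [norm_smul, Padic.norm_p]
  gcongr
  · exact_mod_cast (Fact.out : (p i).Prime).two_le
  · exact norm_le_pi_norm x i

theorem isClosedEmbedding_single [DecidableEq ι] (i : ι) :
    IsClosedEmbedding (AddMonoidHom.single M i) :=
  Function.LeftInverse.isClosedEmbedding (f := fun x : ∀ i, M i => x i)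
    (fun x => Pi.single_eq_same i x) (continuous_apply i) (continuous_single i)

variable [Fintype ι] [DecidableEq ι]

theorem ContinuousAddEquiv.apply_eq_apply_single (hp : Function.Injective p)
    (T : (∀ i, M i) ≃ₜ+ (∀ i, M i)) (x : ∀ i, M i) (i : ι) : T x i = T (Pi.single i (x i)) i := by
  conv_lhs => rw [← Finset.univ_sum_single x, map_sum, Finset.sum_apply]
  refine Finset.sum_eq_single i (fun j _ hj => ?_) (by simp)
  let f : M j →+ M i := ((Pi.evalAddMonoidHom M i).comp (T : (∀ i, M i) →+ _)).comp
    (AddMonoidHom.single M j)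
  exact f.apply_eq_zero_of_prime_ne (hp.ne hj)
    ((continuous_apply i).comp (T.continuous_toFun.comp (continuous_single j))) (x j)

/-- The automorphism induced on the `i`-th factor by an automorphism of a product of vector spaces
over distinct `p`-adic fields. -/
def ContinuousAddEquiv.component (hp : Function.Injective p) (T : (∀ i, M i) ≃ₜ+ (∀ i, M i))
    (i : ι) : M i ≃ₜ+ M i where
  toFun x := T (Pi.single i x) i
  invFun x := T.symm (Pi.single i x) i
  left_inv x := by
    change T.symm (Pi.single i (T (Pi.single i x) i)) i = x
    rw [← T.symm.apply_eq_apply_single hp, T.symm_apply_apply, Pi.single_eq_same]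
  right_inv x := by
    change T (Pi.single i (T.symm (Pi.single i x) i)) i = x
    rw [← T.apply_eq_apply_single hp, T.apply_symm_apply, Pi.single_eq_same]
  map_add' x y := by rw [Pi.single_add, map_add, Pi.add_apply]
  continuous_toFun := (continuous_apply i).comp (T.continuous_toFun.comp (continuous_single i))
  continuous_invFun :=
    (continuous_apply i).comp (T.symm.continuous_toFun.comp (continuous_single i))

theorem ContinuousAddEquiv.apply_eq_component (hp : Function.Injective p)
    (T : (∀ i, M i) ≃ₜ+ (∀ i, M i)) (x : ∀ i, M i) (i : ι) :
    T x i = T.component hp i (x i) :=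
  T.apply_eq_apply_single hp x i

theorem ContinuousAddEquiv.apply_single (hp : Function.Injective p)
    (T : (∀ i, M i) ≃ₜ+ (∀ i, M i)) (i : ι) (x : M i) :
    T (Pi.single i x) = Pi.single i (T.component hp i x) := by
  ext j
  rw [T.apply_eq_component hp]
  rcases eq_or_ne j i with rfl | h
  · simp
  · simp [h]

theorem ContinuousAddEquiv.image_factor (hp : Function.Injective p)
    (T : (∀ i, M i) ≃ₜ+ (∀ i, M i)) (i : ι) : T '' factor i = factor i := by
  have h : ∀ S : (∀ i, M i) ≃ₜ+ (∀ i, M i), ∀ x ∈ factor (M := M) i, S x ∈ factor (M := M) i := by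
    intro S x hx j hj
    rw [S.apply_eq_component hp, hx j hj, map_zero]
  refine Set.Subset.antisymm ?_ fun x hx => ⟨T.symm x, h _ x hx, T.apply_symm_apply x⟩
  rintro _ ⟨x, hx, rfl⟩
  exact h T x hx

/-- On the `i`-th factor the scaling is by the integer `p i`, so it commutes with any additive
block. -/
theorem primeScaling_comm (hp : Function.Injective p) (T : (∀ i, M i) ≃ₜ+ (∀ i, M i))
    (x : ∀ i, M i) : primeScaling p M (T x) = T (primeScaling p M x) := by
  ext i
  rw [T.apply_eq_component hp]
  change (p i : ℚ_[p i]) • T x i = T.component hp i ((p i : ℚ_[p i]) • x i)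
  rw [T.apply_eq_component hp, Nat.cast_smul_eq_nsmul, Nat.cast_smul_eq_nsmul, map_nsmul]

/-- If `T` acts expansively on the closed subgroups, then so do its components. -/
theorem ActsExpansivelyOnSub.component [∀ i, IsUltrametricDist (M i)] [∀ i, ProperSpace (M i)]
    (hp : Function.Injective p)
    {T : (∀ i, M i) ≃ₜ+ (∀ i, M i)} (hT : ActsExpansivelyOnSub T) (i : ι) :
    ActsExpansivelyOnSub (T.component hp i) := by
  obtain ⟨B, -, hB, hc⟩ := exists_countable_basis_isCompact (∀ i, M i)
  have := ClosedAddSubgroup.t2Space_of_basis hB hc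
  refine IsExpansiveHomeo.of_isEmbedding
    (ClosedAddSubgroup.isEmbedding_mapClosedEmbedding _ (isClosedEmbedding_single i))
    (fun H => SetLike.coe_injective ?_) hT
  change (AddMonoidHom.single M i) '' (T.component hp i '' H) = T '' (AddMonoidHom.single M i '' H)
  rw [Set.image_image, Set.image_image]
  exact Set.image_congr fun x _ => (T.apply_single hp i x).symm

end Component

/-! ### A criterion for non-expansiveness; groups generated by one element -/

section ClosedSubgroups

variable {V : Type*} [NormedAddCommGroup V]

/-- If the orbits of distinct closed subgroups `H k`, `H' k` eventually meet the same members of any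
finite family of compact open sets, then `T` does not act expansively on the closed subgroups. -/
theorem not_actsExpansivelyOnSub_of_eventually [IsUltrametricDist V] [ProperSpace V] {T : V ≃ₜ+ V}
    {H H' : ℕ → ClosedAddSubgroup V} (hne : ∀ k, H k ≠ H' k)
    (h : ∀ b : Set V, IsCompact b → IsOpen b → ∀ᶠ k in atTop, ∀ n : ℤ,
      ((((subHomeo T ^ n) (H k) : Set V) ∩ b).Nonempty ↔
        (((subHomeo T ^ n) (H' k) : Set V) ∩ b).Nonempty)) :
    ¬ ActsExpansivelyOnSub T := by
  intro hT
  obtain ⟨B, -, hB, hc⟩ := exists_countable_basis_isCompact V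
  let f : Set V → Set (ClosedAddSubgroup V) := fun b => {A | ((A : Set V) ∩ b).Nonempty}
  obtain ⟨F, hFS, hF, hsep⟩ := IsExpansiveHomeo.exists_finset hT (S := f '' B) (by
      rintro _ ⟨b, hb, rfl⟩
      exact ClosedAddSubgroup.isClopen_setOf_inter_nonempty (hc b hb) (hB.isOpen hb)) (by
      intro H H' hne
      obtain ⟨b, hb, hiff⟩ := ClosedAddSubgroup.exists_inter_nonempty_ne hB hne
      exact ⟨f b, ⟨b, hb, rfl⟩, hiff⟩)
  have hev : ∀ᶠ k in atTop, ∀ s ∈ F, ∀ n : ℤ,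
      ((subHomeo T ^ n) (H k) ∈ s ↔ (subHomeo T ^ n) (H' k) ∈ s) := by
    refine hF.eventually_all.2 fun s hs => ?_
    obtain ⟨b, hb, rfl⟩ := hFS hs
    exact h b (hc b hb) (hB.isOpen hb)
  obtain ⟨k, hk⟩ := hev.exists
  obtain ⟨n, s, hs, hn⟩ := hsep _ _ (hne k)
  exact hn (hk s hs n)

/-- The closed subgroup topologically generated by one element. -/
def closedZMultiples (x : V) : ClosedAddSubgroup V where
  toAddSubgroup := (AddSubgroup.zmultiples x).topologicalClosure
  isClosed' := (AddSubgroup.zmultiples x).isClosed_topologicalClosure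

theorem coe_closedZMultiples (x : V) :
    (closedZMultiples x : Set V) = closure (Set.range fun j : ℤ => j • x) := rfl

theorem closedZMultiples_map (T : V ≃ₜ+ V) (x : V) :
    closedZMultiples (T x) = subHomeo T (closedZMultiples x) := by
  apply SetLike.coe_injective
  change closure (Set.range fun j : ℤ => j • T x) =
    T.toHomeomorph '' closure (Set.range fun j : ℤ => j • x)
  rw [T.toHomeomorph.image_closure, ← Set.range_comp]
  congr 2
  ext j
  exact (map_zsmul T j x).symm

theorem closedZMultiples_inter_nonempty_iff {x : V} {b : Set V} (hb : IsOpen b) :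
    ((closedZMultiples x : Set V) ∩ b).Nonempty ↔ ∃ j : ℤ, j • x ∈ b := by
  rw [coe_closedZMultiples, closure_inter_open_nonempty_iff hb]
  constructor
  · rintro ⟨_, ⟨j, rfl⟩, h⟩
    exact ⟨j, h⟩
  · rintro ⟨j, h⟩
    exact ⟨_, ⟨j, rfl⟩, h⟩

end ClosedSubgroups

/-! ### Obstructions: dimension at least two, and isometries -/

section PadicVectorSpace

variable {p : ℕ} [Fact p.Prime] {V : Type*} [NormedAddCommGroup V] [NormedSpace ℚ_[p] V]

/-- For large `k` the perturbation moves points of norm at most `R` by less than `δ`, and elsewhere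
it is smaller than `‖x‖`, so no outside point lands in `b`. Uniformity in `x` later handles a whole
orbit with one `k`. -/
theorem eventually_add_pow_smul_mem_iff [IsUltrametricDist V] (S : V →L[ℚ_[p]] V) {b : Set V}
    (hb : IsCompact b) (hb' : IsOpen b) :
    ∀ᶠ k : ℕ in atTop, ∀ x, x + (p : ℚ_[p]) ^ k • S x ∈ b ↔ x ∈ b := by
  obtain ⟨δ, hδ, hδb⟩ := hb.exists_thickening_subset_open hb' subset_rfl
  obtain ⟨R, hR0, hR⟩ : ∃ R, 0 ≤ R ∧ ∀ x ∈ b, ‖x‖ ≤ R := by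
    obtain ⟨R, hR⟩ := hb.isBounded.exists_norm_le
    exact ⟨max R 0, le_max_right _ _, fun x hx => (hR x hx).trans (le_max_left _ _)⟩
  have hlim : Tendsto (fun k : ℕ => ‖(p : ℚ_[p])‖ ^ k * ‖S‖) atTop (𝓝 0) := by
    simpa using (tendsto_pow_atTop_nhds_zero_of_lt_one (norm_nonneg _)
      (Padic.norm_p_lt_one (p := p))).mul_const ‖S‖
  have hlim' : Tendsto (fun k : ℕ => ‖(p : ℚ_[p])‖ ^ k * ‖S‖ * R) atTop (𝓝 0) := by
    simpa using hlim.mul_const R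
  filter_upwards [hlim.eventually (gt_mem_nhds one_pos), hlim'.eventually (gt_mem_nhds hδ)]
    with k hk1 hkδ x
  have hle : ‖(p : ℚ_[p]) ^ k • S x‖ ≤ ‖(p : ℚ_[p])‖ ^ k * ‖S‖ * ‖x‖ := by
    rw [norm_smul, norm_pow, mul_assoc]
    gcongr
    exact S.le_opNorm x
  have hsmall : ‖x‖ ≤ R → ‖(p : ℚ_[p]) ^ k • S x‖ < δ := fun hx =>
    (hle.trans (by gcongr)).trans_lt hkδ
  constructor
  · intro h
    have hx : ‖x‖ ≤ R := by
      by_contra! hlt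
      have h1 : ‖(p : ℚ_[p]) ^ k • S x‖ < ‖x‖ :=
        hle.trans_lt (mul_lt_of_lt_one_left (hR0.trans_lt hlt) hk1)
      have h2 := IsUltrametricDist.norm_add_le_max (x + (p : ℚ_[p]) ^ k • S x)
        (-((p : ℚ_[p]) ^ k • S x))
      rw [add_neg_cancel_right, norm_neg] at h2
      exact absurd h2 (not_le.2 (max_lt ((hR _ h).trans_lt hlt) h1))
    exact hδb (mem_thickening_iff.2 ⟨_, h, by simpa [dist_eq_norm] using hsmall hx⟩)
  · intro h
    exact hδb (mem_thickening_iff.2 ⟨_, h, by simpa [dist_eq_norm] using hsmall (hR x h)⟩)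

/-- If some non-scalar endomorphism commutes with `T`, then `T` does not act expansively on the
closed subgroups. -/
theorem not_actsExpansivelyOnSub_of_commute [IsUltrametricDist V] [ProperSpace V] {T : V ≃ₜ+ V}
    (S : V →L[ℚ_[p]] V) (hcomm : ∀ x, S (T x) = T (S x)) {v : V}
    (hv : ∀ c : ℚ_[p], S v ≠ c • v) : ¬ ActsExpansivelyOnSub T := by
  have hTlin : ∀ (c : ℚ_[p]) x, T (c • x) = c • T x :=
    (T : V →+ V).map_padic_smul T.continuous_toFun
  have hpk : ∀ k : ℕ, (p : ℚ_[p]) ^ k ≠ 0 := fun k =>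
    pow_ne_zero k (Nat.cast_ne_zero.2 (NeZero.ne p))
  refine not_actsExpansivelyOnSub_of_eventually (H := fun _ => closedZMultiples v)
    (H' := fun k => closedZMultiples (v + (p : ℚ_[p]) ^ k • S v)) (fun k heq => ?_) ?_
  · have hsub : (closedZMultiples v : Set V) ⊆ (ℚ_[p] ∙ v : Submodule ℚ_[p] V) := by
      rw [coe_closedZMultiples]
      refine closure_minimal ?_ (Submodule.closed_of_finiteDimensional _)
      rintro _ ⟨j, rfl⟩
      exact zsmul_mem (Submodule.mem_span_singleton_self v) j
    have hmem : v + (p : ℚ_[p]) ^ k • S v ∈ closedZMultiples v := by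
      rw [heq]
      exact subset_closure ⟨1, one_zsmul _⟩
    have h1 : (p : ℚ_[p]) ^ k • S v ∈ (ℚ_[p] ∙ v : Submodule ℚ_[p] V) :=
      (Submodule.add_mem_iff_right _ (Submodule.mem_span_singleton_self v)).1 (hsub hmem)
    rw [Submodule.smul_mem_iff _ (hpk k)] at h1
    obtain ⟨c, hc⟩ := Submodule.mem_span_singleton.1 h1
    exact hv c hc.symm
  · intro b hb hb'
    filter_upwards [eventually_add_pow_smul_mem_iff S hb hb'] with k hk n
    -- The map `1 + p ^ k • S` commutes with `T`, so it carries the orbit of `v` to that of the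
    -- perturbed generator.
    have hg : ∀ x, T.toHomeomorph x + (p : ℚ_[p]) ^ k • S (T.toHomeomorph x) =
        T.toHomeomorph (x + (p : ℚ_[p]) ^ k • S x) := by
      intro x
      change T x + (p : ℚ_[p]) ^ k • S (T x) = T (x + (p : ℚ_[p]) ^ k • S x)
      rw [map_add, hTlin, hcomm]
    have horb : ∀ x, (subHomeo T ^ n) (closedZMultiples x) =
        closedZMultiples ((T.toHomeomorph ^ n) x) := fun x =>
      (Homeomorph.semiconj_zpow (φ := T.toHomeomorph) (closedZMultiples_map T) n x).symm
    rw [horb, horb, ← Homeomorph.semiconj_zpow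
      (F := fun x => x + (p : ℚ_[p]) ^ k • S x) (φ := T.toHomeomorph) hg,
      closedZMultiples_inter_nonempty_iff hb', closedZMultiples_inter_nonempty_iff hb']
    refine exists_congr fun j => ?_
    rw [← hk (j • _), map_zsmul, smul_add, smul_comm _ j]

/-- An automorphism of a `p`-adic vector space of dimension at least two does not act expansively on
the closed subgroups. -/
theorem not_actsExpansivelyOnSub_of_two_le {m : ℕ} (hm : 2 ≤ m)
    (T : (Fin m → ℚ_[p]) ≃ₜ+ (Fin m → ℚ_[p])) : ¬ ActsExpansivelyOnSub T := by
  have hTlin : ∀ (c : ℚ_[p]) x, T (c • x) = c • T x :=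
    AddMonoidHom.map_padic_smul (T : (Fin m → ℚ_[p]) →+ (Fin m → ℚ_[p])) T.continuous_toFun
  let f : (Fin m → ℚ_[p]) →ₗ[ℚ_[p]] (Fin m → ℚ_[p]) :=
    { toFun := T, map_add' := map_add T, map_smul' := hTlin }
  have hf : ∀ x, f x = T x := fun x => rfl
  -- Either `T` is scalar and commutes with the rank-one map sending one basis vector to another, or
  -- `T` itself serves as `S`.
  by_cases h : ∀ v, ¬ LinearIndependent ℚ_[p] ![v, f v]
  · obtain ⟨a, ha⟩ := f.exists_eq_smul_id_of_forall_notLinearIndependent h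
    have ha' : ∀ x, T x = a • x := fun x => by rw [← hf, ha]; rfl
    let i : Fin m := ⟨0, by omega⟩
    let j : Fin m := ⟨1, by omega⟩
    let S : (Fin m → ℚ_[p]) →ₗ[ℚ_[p]] (Fin m → ℚ_[p]) :=
      (LinearMap.single ℚ_[p] (fun _ : Fin m => ℚ_[p]) j).comp (LinearMap.proj i)
    refine not_actsExpansivelyOnSub_of_commute S.toContinuousLinearMap
      (fun x => by rw [ha', ha', map_smul]) (v := Pi.single i 1) fun c hc => ?_
    have hij : j ≠ i := by simp [i, j]
    have := congrFun hc j
    simp [S, hij] at this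
  · push Not at h
    obtain ⟨v, hv⟩ := h
    refine not_actsExpansivelyOnSub_of_commute f.toContinuousLinearMap (fun x => rfl) (v := v)
      fun c hc => ?_
    have := LinearIndependent.pair_iff.1 hv c (-1) (by
      rw [neg_one_smul, ← sub_eq_add_neg, sub_eq_zero]
      exact hc.symm)
    exact neg_ne_zero.2 one_ne_zero this.2

/-- An isometric automorphism of `ℚ_[p]` does not act expansively on the
closed subgroups. -/
theorem not_actsExpansivelyOnSub_of_norm_eq {T : ℚ_[p] ≃ₜ+ ℚ_[p]} (hT : ∀ x, ‖T x‖ = ‖x‖) : ¬ ActsExpansivelyOnSub T := by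
  let B : ℝ → ClosedAddSubgroup ℚ_[p] := fun r =>
    { carrier := {x | ‖x‖ ≤ ‖r‖}
      zero_mem' := by simp
      add_mem' := fun {x y} hx hy =>
        (IsUltrametricDist.norm_add_le_max x y).trans (max_le hx hy)
      neg_mem' := fun {x} hx => by simpa using hx
      isClosed' := isClosed_le continuous_norm continuous_const }
  have hB : ∀ r x, x ∈ B r ↔ ‖x‖ ≤ ‖r‖ := fun r x => Iff.rfl
  have hfix : ∀ r (n : ℤ), (subHomeo T ^ n) (B r) = B r := by
    intro r n
    have h1 : B r = subHomeo T (B r) := by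
      apply SetLike.coe_injective
      ext x
      constructor
      · exact fun hx => ⟨T.symm x, by
          change ‖T.symm x‖ ≤ ‖r‖
          rw [← hT, T.apply_symm_apply]
          exact hx, T.apply_symm_apply x⟩
      · rintro ⟨y, hy, rfl⟩
        exact (hT y).le.trans hy
    exact (Homeomorph.semiconj_zpow (φ := Homeomorph.refl Unit) (F := fun _ => B r)
      (fun _ => h1) n ()).symm
  -- An isometry fixes all balls centred at `0`, and these shrink to the trivial subgroup without
  -- ever equalling it.
  refine not_actsExpansivelyOnSub_of_eventually (H := fun k => B ‖p ^ k • (1 : ℚ_[p])‖) (H' := fun _ => B 0)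
    (fun k heq => ?_) fun b hb hb' => ?_
  · have : p ^ k • (1 : ℚ_[p]) ∈ B 0 := by
      rw [← heq, hB, norm_norm]
    rw [hB, norm_zero, norm_le_zero_iff, ← Nat.cast_smul_eq_nsmul ℚ_[p], smul_eq_zero,
      Nat.cast_eq_zero] at this
    exact this.elim (pow_ne_zero k (NeZero.ne p)) one_ne_zero
  · by_cases h0 : (0 : ℚ_[p]) ∈ b
    · exact Eventually.of_forall fun k n => by
        simp only [hfix]
        exact iff_of_true ⟨0, zero_mem _, h0⟩ ⟨0, zero_mem _, h0⟩
    · obtain ⟨ε, hε, hεb⟩ := Metric.isOpen_iff.1 hb.isClosed.isOpen_compl 0 h0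
      have hlim := (tendsto_pow_smul_zero (p := p) (1 : ℚ_[p])).norm
      rw [norm_zero] at hlim
      filter_upwards [hlim.eventually (gt_mem_nhds hε)] with k hk n
      simp only [hfix]
      have hempty : ∀ r : ℝ, ‖r‖ < ε → ¬ ((B r : Set ℚ_[p]) ∩ b).Nonempty := by
        rintro r hr ⟨x, hx, hxb⟩
        exact hεb (mem_ball_zero_iff.2 (((hB r x).1 hx).trans_lt hr)) hxb
      exact iff_of_false (hempty _ (by rwa [norm_norm])) (hempty _ (by simpa using hε))

end PadicVectorSpace

/-! ### Integer powers of the action -/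

section Action

variable {G : Type*} [AddGroup G] [TopologicalSpace G]

theorem mem_subHomeo (T : G ≃ₜ+ G) (H : ClosedAddSubgroup G) (x : G) :
    x ∈ subHomeo T H ↔ T.symm x ∈ H :=
  ⟨by rintro ⟨y, hy, rfl⟩; exact (T.symm_apply_apply y).symm ▸ hy,
    fun h => ⟨T.symm x, h, T.apply_symm_apply x⟩⟩

theorem mem_subHomeo_zpow (T : G ≃ₜ+ G) (n : ℤ) (H : ClosedAddSubgroup G) (x : G) :
    x ∈ (subHomeo T ^ n) H ↔ (T.toHomeomorph ^ (-n)) x ∈ H := by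
  induction n generalizing H with
  | zero => exact Iff.rfl
  | succ n ih =>
    rw [zpow_add_one, Homeomorph.mul_apply, ih, mem_subHomeo, neg_add_rev, zpow_add, zpow_neg_one,
      Homeomorph.mul_apply]
    exact Iff.rfl
  | pred n ih =>
    rw [zpow_sub_one, Homeomorph.mul_apply, ih, neg_sub, sub_neg_eq_add, neg_neg, zpow_add, zpow_one,
      Homeomorph.mul_apply]
    exact mem_subHomeo T.symm H _

theorem Homeomorph.zpow_apply_of_eq_mul {K : Type*} [DivisionRing K] [TopologicalSpace K]
    {φ : K ≃ₜ K} {a : K} (ha : a ≠ 0) (h : ∀ x, φ x = a * x) (n : ℤ) (x : K) :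
    (φ ^ n) x = a ^ n * x := by
  induction n generalizing x with
  | zero => simp
  | succ n ih => rw [zpow_add_one, Homeomorph.mul_apply, ih, h, zpow_add_one₀ ha, mul_assoc]
  | pred n ih =>
    rw [zpow_sub_one, Homeomorph.mul_apply, ih, zpow_sub_one₀ ha, mul_assoc]
    congr 1
    change φ.symm x = _
    rw [φ.symm_apply_eq, h, mul_inv_cancel_left₀ ha]

end Action

/-! ### Closed subgroups of `ℚ_[p]` -/

section Padic

variable {p : ℕ} [Fact p.Prime]

/-- Closed subgroups of `ℚ_[p]` are stable under multiplication by `p`-adic integers. -/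
theorem ClosedAddSubgroup.mem_of_norm_le (H : ClosedAddSubgroup ℚ_[p]) {y z : ℚ_[p]} (hy : y ∈ H)
    (h : ‖z‖ ≤ ‖y‖) : z ∈ H := by
  rcases eq_or_ne y 0 with rfl | hy0
  · rw [norm_zero, norm_le_zero_iff] at h
    exact h ▸ hy
  · have key : ∀ c : ℤ_[p], (c : ℚ_[p]) * y ∈ H := fun c => by
      refine isClosed_property (p := fun c : ℤ_[p] => (c : ℚ_[p]) * y ∈ H)
        PadicInt.denseRange_intCast ?_ (fun j => ?_) c
      · exact IsClosed.preimage (continuous_subtype_val.mul continuous_const) H.isClosed'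
      · simpa using zsmul_mem hy j
    have hc : ‖z / y‖ ≤ 1 := by
      rw [norm_div]
      exact div_le_one_of_le₀ h (norm_nonneg _)
    simpa [hy0] using key ⟨z / y, hc⟩

theorem Padic.norm_eq_norm_zpow_valuation {x : ℚ_[p]} (hx : x ≠ 0) :
    ‖x‖ = ‖(p : ℚ_[p]) ^ x.valuation‖ := by
  rw [Padic.norm_p_zpow, Padic.norm_eq_zpow_neg_valuation hx]

/-- All points of the compact open ball `ball x ‖x‖` have norm `‖x‖`, so a closed subgroup meeting
it contains `x`. -/
theorem ClosedAddSubgroup.isClopen_setOf_mem {x : ℚ_[p]} (hx : x ≠ 0) :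
    IsClopen {H : ClosedAddSubgroup ℚ_[p] | x ∈ H} := by
  have hb := ClosedAddSubgroup.isClopen_setOf_inter_nonempty (b := ball x ‖x‖)
    ((isCompact_closedBall x ‖x‖).of_isClosed_subset (IsUltrametricDist.isClosed_ball x ‖x‖)
      ball_subset_closedBall) isOpen_ball
  convert hb using 1
  ext H
  constructor
  · exact fun h => ⟨x, h, mem_ball_self (norm_pos_iff.2 hx)⟩
  · rintro ⟨y, hy, hxy⟩
    refine H.mem_of_norm_le hy (le_of_eq ?_)
    exact (Padic.norm_eq_of_norm_sub_lt_right (by simpa [dist_eq_norm] using hxy)).symm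

theorem Padic.valuation_ne_zero_of_norm_ne_one {a : ℚ_[p]} (ha : a ≠ 0) (h : ‖a‖ ≠ 1) :
    a.valuation ≠ 0 := fun h0 => h (by
  rw [Padic.norm_eq_zpow_neg_valuation ha, h0, neg_zero, zpow_zero])

/-- Distinct closed subgroups of `ℚ_[p]` are moved by multiplication by powers of `a`, `‖a‖ ≠ 1`, so
that one of finitely many fixed powers of `p` distinguishes them. -/
theorem ClosedAddSubgroup.exists_zpow_mul_mem_ne {a : ℚ_[p]} (ha : a ≠ 0) (ha1 : ‖a‖ ≠ 1)
    {H H' : ClosedAddSubgroup ℚ_[p]} (h : H ≠ H') :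
    ∃ n : ℤ, ∃ k < a.valuation.natAbs,
      ¬ (a ^ (-n) * (p : ℚ_[p]) ^ k ∈ H ↔ a ^ (-n) * (p : ℚ_[p]) ^ k ∈ H') := by
  have hc := Padic.valuation_ne_zero_of_norm_ne_one ha ha1
  have hp0 : (p : ℚ_[p]) ≠ 0 := Nat.cast_ne_zero.2 (NeZero.ne p)
  have key : ∀ H H' : ClosedAddSubgroup ℚ_[p], ¬ (H : Set ℚ_[p]) ⊆ H' →
      ∃ n : ℤ, ∃ k < a.valuation.natAbs,
      ¬ (a ^ (-n) * (p : ℚ_[p]) ^ k ∈ H ↔ a ^ (-n) * (p : ℚ_[p]) ^ k ∈ H') := by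
    intro H H' h
    obtain ⟨x, hx, hx'⟩ := Set.not_subset.1 h
    have hx0 : x ≠ 0 := fun h0 => hx' (h0 ▸ zero_mem H')
    have hnn := Int.emod_nonneg x.valuation hc
    have hlt := Int.emod_lt_abs x.valuation hc
    have hdiv := Int.emod_add_mul_ediv x.valuation a.valuation
    rw [Int.abs_eq_natAbs] at hlt
    -- Division with remainder `v(x) = q * v(a) + k` makes `a ^ q * p ^ k` an element of the same
    -- norm as `x`; the sign matches `a ^ (-n)`.
    refine ⟨-(x.valuation / a.valuation), (x.valuation % a.valuation).toNat, by omega, ?_⟩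
    have hnorm : ‖a ^ (-(-(x.valuation / a.valuation))) *
        (p : ℚ_[p]) ^ (x.valuation % a.valuation).toNat‖ = ‖x‖ := by
      rw [norm_mul, norm_zpow, Padic.norm_eq_norm_zpow_valuation ha,
        Padic.norm_eq_norm_zpow_valuation hx0, ← norm_zpow, ← norm_mul, ← zpow_mul,
        ← zpow_natCast, Int.toNat_of_nonneg hnn, neg_neg, ← zpow_add₀ hp0]
      congr 2
      linarith
    intro hiff
    exact hx' (H'.mem_of_norm_le (hiff.1 (H.mem_of_norm_le hx hnorm.le)) hnorm.ge)
  by_cases h1 : (H : Set ℚ_[p]) ⊆ H'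
  · have h2 : ¬ (H' : Set ℚ_[p]) ⊆ H := fun h2 => h (SetLike.coe_injective (h1.antisymm h2))
    obtain ⟨n, k, hk, hne⟩ := key _ _ h2
    exact ⟨n, k, hk, fun hiff => hne hiff.symm⟩
  · exact key _ _ h1

end Padic

/-! ### Closed subgroups of a product over distinct primes -/

section PadicProduct

variable {ι : Type*} {p : ι → ℕ} [∀ i, Fact (p i).Prime]

namespace ClosedAddSubgroup

/-- The product of closed subgroups. -/
noncomputable def pi (H : ∀ i, ClosedAddSubgroup ℚ_[p i]) : ClosedAddSubgroup (∀ i, ℚ_[p i]) where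
  toAddSubgroup := AddSubgroup.pi Set.univ fun i => (H i).toAddSubgroup
  isClosed' := isClosed_set_pi fun i _ => (H i).isClosed'

theorem mem_pi {H : ∀ i, ClosedAddSubgroup ℚ_[p i]} {x : ∀ i, ℚ_[p i]} :
    x ∈ pi H ↔ ∀ i, x i ∈ H i :=
  ⟨fun h i => h i trivial, fun h i _ => h i⟩

variable [DecidableEq ι]

/-- The intersection of a closed subgroup of a product with the `i`-th factor. -/
noncomputable def fiber (H : ClosedAddSubgroup (∀ i, ℚ_[p i])) (i : ι) : ClosedAddSubgroup ℚ_[p i] where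
  toAddSubgroup := H.toAddSubgroup.comap (AddMonoidHom.single (fun i => ℚ_[p i]) i)
  isClosed' := H.isClosed'.preimage (continuous_single i)

theorem mem_fiber {H : ClosedAddSubgroup (∀ i, ℚ_[p i])} {i : ι} {x : ℚ_[p i]} :
    x ∈ H.fiber i ↔ Pi.single i x ∈ H := Iff.rfl

theorem fiber_pi (H : ∀ i, ClosedAddSubgroup ℚ_[p i]) (i : ι) : (pi H).fiber i = H i := by
  apply SetLike.coe_injective
  ext x
  simp only [SetLike.mem_coe, mem_fiber, mem_pi]
  refine ⟨fun h => by simpa using h i, fun h j => ?_⟩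
  rcases eq_or_ne j i with rfl | hji
  · simpa using h
  · simp [hji]

end ClosedAddSubgroup

variable [Fintype ι] [DecidableEq ι]

/-- There are integers tending to `1` in `ℚ_[p i]` and to `0` in `ℚ_[p j]` for all `j ≠ i`. -/
theorem exists_int_tendsto_single (hp : Function.Injective p) (i : ι) :
    ∃ N : ℕ → ℤ, ∀ j, Tendsto (fun k => (N k : ℚ_[p j])) atTop (𝓝 (if j = i then 1 else 0)) := by
  have hcop : ∀ k : ℕ, IsCoprime ((p i : ℤ) ^ k) ((∏ j ∈ Finset.univ.erase i, (p j : ℤ)) ^ k) := by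
    intro k
    refine (IsCoprime.prod_right fun j hj => ?_).pow
    exact Nat.isCoprime_iff_coprime.2 ((Nat.coprime_primes Fact.out Fact.out).2
      (hp.ne (Finset.ne_of_mem_erase hj).symm))
  -- The Bézout term divisible by the `k`-th powers of the other primes is small at those primes and
  -- close to `1` at `p i`.
  choose u v huv using hcop
  have hlim : ∀ (j : ι) (x : ℕ → ℤ), (∀ k, (p j : ℤ) ^ k ∣ x k) →
      Tendsto (fun k => (x k : ℚ_[p j])) atTop (𝓝 0) := by
    intro j x hx
    refine squeeze_zero_norm (a := fun k => ((p j : ℝ)⁻¹) ^ k) (fun k => ?_) ?_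
    · have := (Padic.norm_int_le_pow_iff_dvd (p := p j) (x k) k).2 (by exact_mod_cast hx k)
      simpa using this
    · refine tendsto_pow_atTop_nhds_zero_of_lt_one (by positivity) (inv_lt_one_of_one_lt₀ ?_)
      exact_mod_cast (Fact.out : (p j).Prime).one_lt
  refine ⟨fun k => v k * (∏ j ∈ Finset.univ.erase i, (p j : ℤ)) ^ k, fun j => ?_⟩
  split_ifs with hji
  · subst hji
    have h1 := (hlim j (fun k => u k * (p j : ℤ) ^ k) fun k => dvd_mul_left _ _).const_sub 1
    rw [sub_zero] at h1
    refine h1.congr fun k => ?_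
    have := congrArg (Int.cast : ℤ → ℚ_[p j]) (huv k)
    push_cast at this ⊢
    linear_combination -this
  · exact hlim j _ fun k => Dvd.dvd.mul_left (pow_dvd_pow_of_dvd (Finset.dvd_prod_of_mem _
      (Finset.mem_erase.2 ⟨hji, Finset.mem_univ j⟩)) k) _

namespace ClosedAddSubgroup

/-- The integer multiples `N k • x` stay in `H` and converge to the `i`-th coordinate part of `x`.
-/
theorem apply_mem_fiber (hp : Function.Injective p) {H : ClosedAddSubgroup (∀ i, ℚ_[p i])}
    {x : ∀ i, ℚ_[p i]} (hx : x ∈ H) (i : ι) : x i ∈ H.fiber i := by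
  obtain ⟨N, hN⟩ := exists_int_tendsto_single hp i
  rw [mem_fiber]
  refine H.isClosed'.mem_of_tendsto (f := fun k => N k • x) (b := atTop) (tendsto_pi_nhds.2 fun j => ?_)
    (Eventually.of_forall fun k => zsmul_mem hx (N k))
  have h := (hN j).mul_const (x j)
  simp only [Pi.smul_apply, zsmul_eq_mul]
  convert h using 2
  rcases eq_or_ne j i with rfl | hji
  · simp
  · simp [hji]

theorem mem_iff_forall_mem_fiber (hp : Function.Injective p)
    {H : ClosedAddSubgroup (∀ i, ℚ_[p i])} {x : ∀ i, ℚ_[p i]} :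
    x ∈ H ↔ ∀ i, x i ∈ H.fiber i := by
  refine ⟨fun hx => apply_mem_fiber hp hx, fun h => ?_⟩
  rw [← Finset.univ_sum_single x]
  exact sum_mem fun i _ => h i

theorem continuous_fiber (hp : Function.Injective p) (i : ι) :
    Continuous fun H : ClosedAddSubgroup (∀ i, ℚ_[p i]) => H.fiber i := by
  refine continuous_generateFrom_iff.2 ?_
  rintro S (⟨K, hK, rfl⟩ | ⟨U, hU, rfl⟩)
  · convert isOpen_setOf_inter_eq_empty (hK.image (continuous_single (A := fun i => ℚ_[p i]) i))
      using 1
    ext H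
    simp only [Set.mem_preimage, Set.mem_ofPred_eq]
    rw [← Set.image_preimage_inter, Set.image_eq_empty]
    rfl
  · convert isOpen_setOf_inter_nonempty (hU.preimage (continuous_apply (A := fun i => ℚ_[p i]) i))
      using 1
    ext H
    constructor
    · rintro ⟨x, hx, hxU⟩
      exact ⟨Pi.single i x, hx, by simpa using hxU⟩
    · rintro ⟨x, hx, hxU⟩
      exact ⟨x i, apply_mem_fiber hp hx i, hxU⟩

theorem pi_fiber (hp : Function.Injective p) (H : ClosedAddSubgroup (∀ i, ℚ_[p i])) :
    pi H.fiber = H := by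
  apply SetLike.coe_injective
  ext x
  simp only [SetLike.mem_coe, mem_pi]
  exact (mem_iff_forall_mem_fiber hp).symm

/-- The closed subgroups of a product of distinct `p`-adic fields are the products of closed
subgroups of the factors. -/
noncomputable def piHomeomorph (hp : Function.Injective p) :
    (∀ i, ClosedAddSubgroup ℚ_[p i]) ≃ₜ ClosedAddSubgroup (∀ i, ℚ_[p i]) :=
  have : ∀ i, T2Space (ClosedAddSubgroup ℚ_[p i]) := fun i => by
    obtain ⟨B, -, hB, hc⟩ := exists_countable_basis_isCompact ℚ_[p i]
    exact t2Space_of_basis hB hc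
  -- Only continuity of passing to fibers is needed, the source being compact and the target
  -- Hausdorff.
  (Continuous.homeoOfEquivCompactToT2
    (f :=
      { toFun := fun H : ClosedAddSubgroup (∀ i, ℚ_[p i]) => H.fiber
        invFun := pi
        left_inv := pi_fiber hp
        right_inv := fun H => funext (fiber_pi H) })
    (continuous_pi fun i => continuous_fiber hp i)).symm

theorem coe_piHomeomorph (hp : Function.Injective p) (H : ∀ i, ClosedAddSubgroup ℚ_[p i]) :
    (piHomeomorph hp H : Set (∀ i, ℚ_[p i])) = Set.univ.pi fun i => (H i : Set ℚ_[p i]) := rfl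

end ClosedAddSubgroup

/-! ### Both kinds of expansiveness in terms of the multipliers -/

section Expansive

variable (hp : Function.Injective p) (T : (∀ i, ℚ_[p i]) ≃ₜ+ (∀ i, ℚ_[p i]))

theorem ContinuousAddEquiv.component_apply_eq_mul (i : ι) (x : ℚ_[p i]) :
    T.component hp i x = T.component hp i 1 * x := by
  have := AddMonoidHom.map_padic_smul (T.component hp i : ℚ_[p i] →+ ℚ_[p i])
    (T.component hp i).continuous_toFun x 1
  rw [smul_eq_mul, smul_eq_mul, mul_one] at this
  exact this.trans (mul_comm _ _)

theorem ContinuousAddEquiv.component_one_ne_zero (i : ι) : T.component hp i 1 ≠ 0 :=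
  (map_ne_zero_iff _ (T.component hp i).injective).2 one_ne_zero

theorem ContinuousAddEquiv.zpow_apply_eq_mul (n : ℤ) (x : ∀ i, ℚ_[p i]) (i : ι) :
    (T.toHomeomorph ^ n) x i = T.component hp i 1 ^ n * x i := by
  rw [← Homeomorph.zpow_apply_of_eq_mul (φ := (T.component hp i).toHomeomorph)
    (T.component_one_ne_zero hp i) (T.component_apply_eq_mul hp i)]
  exact Homeomorph.semiconj_zpow (F := fun x : ∀ i, ℚ_[p i] => x i) (φ := T.toHomeomorph)
    (fun x => T.apply_eq_component hp x i) n x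

/-- A multiplier of norm one leaves small vectors on its axis small forever; any other makes every
nonzero coordinate unbounded along the two-sided orbit. -/
theorem isExpansiveAut_iff_norm_ne_one :
    IsExpansiveAut T ↔ ∀ i, ‖T.component hp i 1‖ ≠ 1 := by
  constructor
  · rintro ⟨U, hU, h⟩ i h1
    have hlim : Tendsto (fun k : ℕ => (Pi.single i (p i ^ k • (1 : ℚ_[p i])) : ∀ i, ℚ_[p i])) atTop
        (𝓝 0) := by
      have := ((continuous_single (A := fun i => ℚ_[p i]) i).tendsto 0).comp
        (tendsto_pow_smul_zero (p := p i) (1 : ℚ_[p i]))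
      rwa [Pi.single_zero] at this
    obtain ⟨ε, hε, hεU⟩ := Metric.mem_nhds_iff.1 hU
    obtain ⟨k, hk⟩ := (hlim.eventually (ball_mem_nhds 0 hε)).exists
    have hmem : (Pi.single i (p i ^ k • (1 : ℚ_[p i])) : ∀ i, ℚ_[p i]) ∈
        ⋂ n : ℤ, (T.toHomeomorph ^ n) '' U := by
      refine Set.mem_iInter.2 fun n => 
        ⟨(T.toHomeomorph ^ (-n)) (Pi.single i (p i ^ k • (1 : ℚ_[p i]))), hεU ?_, ?_⟩
      · rw [dist_zero_right] at hk
        rw [mem_ball_zero_iff]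
        refine lt_of_le_of_lt ((pi_norm_le_iff_of_nonneg (norm_nonneg _)).2 fun j => ?_) hk
        rw [T.zpow_apply_eq_mul hp]
        rcases eq_or_ne j i with rfl | hji
        · rw [norm_mul, norm_zpow, h1, one_zpow, one_mul]
          exact norm_le_pi_norm _ j
        · rw [Pi.single_eq_of_ne hji, mul_zero, norm_zero]
          exact norm_nonneg _
      · rw [← Homeomorph.mul_apply, ← zpow_add, add_neg_cancel, zpow_zero, Homeomorph.one_apply]
    rw [h, Set.mem_singleton_iff, Pi.single_eq_zero_iff, ← Nat.cast_smul_eq_nsmul ℚ_[p i],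
      smul_eq_zero, Nat.cast_eq_zero] at hmem
    exact hmem.elim (pow_ne_zero k (NeZero.ne (p i))) one_ne_zero
  · intro h
    refine ⟨closedBall 0 1, closedBall_mem_nhds 0 one_pos, Set.Subset.antisymm ?_ ?_⟩
    · intro x hx
      by_contra hx0
      obtain ⟨i, hi⟩ := Function.ne_iff.1 hx0
      have hi : x i ≠ 0 := hi
      have ha := T.component_one_ne_zero hp i
      have hbd : ∀ n : ℤ, 0 ≤ n * (T.component hp i 1).valuation + (x i).valuation := by
        intro n
        obtain ⟨y, hy, hyx⟩ := Set.mem_iInter.1 hx (-n)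
        have hy' : y = (T.toHomeomorph ^ n) x := by
          rw [← hyx, ← Homeomorph.mul_apply, ← zpow_add, add_neg_cancel, zpow_zero,
            Homeomorph.one_apply]
        have h1 : ‖y i‖ ≤ 1 := (norm_le_pi_norm y i).trans (mem_closedBall_zero_iff.1 hy)
        rwa [hy', T.zpow_apply_eq_mul hp, Padic.norm_le_one_iff_val_nonneg,
          Padic.valuation_mul (zpow_ne_zero n ha) hi, Padic.valuation_zpow] at h1
      have hc := Padic.valuation_ne_zero_of_norm_ne_one ha (h i)
      -- This exponent makes the valuation negative, since the square of the multiplier's valuation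
      -- is at least `1`.
      have h1 := hbd (-(T.component hp i 1).valuation * (|(x i).valuation| + 1))
      have h2 : 1 ≤ (T.component hp i 1).valuation * (T.component hp i 1).valuation :=
        Int.add_one_le_of_lt (mul_self_pos.2 hc)
      nlinarith [le_abs_self (x i).valuation, abs_nonneg (x i).valuation]
    · rintro _ rfl
      refine Set.mem_iInter.2 fun n => ⟨0, by simp, ?_⟩
      ext i
      rw [T.zpow_apply_eq_mul hp]
      simp

theorem actsExpansivelyOnSub_iff_norm_ne_one :
    ActsExpansivelyOnSub T ↔ ∀ i, ‖T.component hp i 1‖ ≠ 1 := by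
  constructor
  · intro h i h1
    refine not_actsExpansivelyOnSub_of_norm_eq (fun x => ?_) (h.component hp i)
    rw [T.component_apply_eq_mul hp, norm_mul, h1, one_mul]
  · intro h
    have : TopologicalSpace.MetrizableSpace (ClosedAddSubgroup (∀ i, ℚ_[p i])) := by
      obtain ⟨B, hB', hB, hc⟩ := exists_countable_basis_isCompact (∀ i, ℚ_[p i])
      exact ClosedAddSubgroup.metrizableSpace_of_countable_basis hB hc hB'
    -- The powers `p i ^ k` with `k` below the absolute valuation of the multiplier represent all
    -- valuations modulo its powers, so these finitely many tests suffice.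
    refine IsExpansiveHomeo.of_isClopen
      (ι := Σ i, Fin (T.component hp i 1).valuation.natAbs)
      (s := fun q => {H | (p q.1 : ℚ_[p q.1]) ^ (q.2 : ℕ) ∈ H.fiber q.1}) (fun q => ?_)
      fun H H' hne => ?_
    · exact (ClosedAddSubgroup.isClopen_setOf_mem
        (pow_ne_zero _ (Nat.cast_ne_zero.2 (NeZero.ne (p q.1))))).preimage
        (ClosedAddSubgroup.continuous_fiber hp q.1)
    · obtain ⟨i, hi⟩ : ∃ i, H.fiber i ≠ H'.fiber i := by
        by_contra! heq
        exact hne (by rw [← H.pi_fiber hp, ← H'.pi_fiber hp, funext heq])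
      obtain ⟨n, k, hk, hnk⟩ := ClosedAddSubgroup.exists_zpow_mul_mem_ne
        (T.component_one_ne_zero hp i) (h i) hi
      have hmem : ∀ K : ClosedAddSubgroup (∀ i, ℚ_[p i]),
          (p i : ℚ_[p i]) ^ k ∈ ((subHomeo T ^ n) K).fiber i ↔
            T.component hp i 1 ^ (-n) * (p i : ℚ_[p i]) ^ k ∈ K.fiber i := by
        intro K
        rw [ClosedAddSubgroup.mem_fiber, ClosedAddSubgroup.mem_fiber, mem_subHomeo_zpow]
        convert Iff.rfl using 2
        ext j
        rw [T.zpow_apply_eq_mul hp]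
        rcases eq_or_ne j i with rfl | hji
        · simp
        · simp [hji]
      refine ⟨n, ⟨i, k, hk⟩, ?_⟩
      simpa only [Set.mem_ofPred_eq, hmem] using hnk

end Expansive

end PadicProduct

theorem corollary4p6 (n : ℕ) (p : Fin n → ℕ) [∀ i, Fact (p i).Prime]
    (hp : Function.Injective p) :
    -- (1)
    (∀ m : Fin n → ℕ, (∀ i, 1 ≤ m i) →
      ∀ T : (∀ i, Fin (m i) → ℚ_[p i]) ≃ₜ+ (∀ i, Fin (m i) → ℚ_[p i]),
        (IsExpansiveAut T →
          (∀ i, T '' factor i = factor i) ∧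
          IsInternalDirectProduct (contractionGroup T) (contractionGroup T.symm)) ∧
        (ActsExpansivelyOnSub T → ∀ i, m i = 1)) ∧
    -- (2)
    (∀ T : (∀ i, ℚ_[p i]) ≃ₜ+ (∀ i, ℚ_[p i]), IsExpansiveAut T ↔ ActsExpansivelyOnSub T) ∧
    (∃ Φ : (∀ i, ClosedAddSubgroup ℚ_[p i]) ≃ₜ ClosedAddSubgroup (∀ i, ℚ_[p i]),
      ∀ H : ∀ i, ClosedAddSubgroup ℚ_[p i],
        (Φ H : Set (∀ i, ℚ_[p i])) = Set.univ.pi fun i => (H i : Set ℚ_[p i])) := by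
  refine ⟨fun m hm T => ⟨fun hT => ⟨T.image_factor hp, ?_⟩, fun hT i => ?_⟩, fun T => ?_,
    ClosedAddSubgroup.piHomeomorph hp, ClosedAddSubgroup.coe_piHomeomorph hp⟩
  · exact hT.isInternalDirectProduct (σ := primeScaling p fun i => Fin (m i) → ℚ_[p i])
      (by norm_num) (by norm_num) norm_primeScaling_le (primeScaling_comm hp T)
  · by_contra h1
    exact not_actsExpansivelyOnSub_of_two_le ((hm i).lt_of_ne (Ne.symm h1)) _
      (hT.component hp i)
  · rw [isExpansiveAut_iff_norm_ne_one hp, actsExpansivelyOnSub_iff_norm_ne_one hp]
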